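/- **Setting.** For $N\ge 0$ and $d\ge 1$ let $\mathbb R^{d,N}_{\neq}=\{(x_1,\dots,x_N)\in(\mathbb R^d)^N : x_i\neq x_j \text{ for } i\ne j\}$ be the space of ordered non-collision configurations, ${}^N\mathbb R^d$ the set of $N$-element subsets of $\mathbb R^d$ (unordered configurations), and $\pi:\mathbb R^{d,N}_{\neq}\to{}^N\mathbb R^d$, $\pi(x_1,\dots,x_N)=\{x_1,\dots,x_N\}$. The space ${}^N\mathbb R^d$ carries the quotient topology and the smooth structure for which the covering map $\pi$ is a local diffeomorphism. A loop $\alpha$ in ${}^N\mathbb R^d$ based at $q$ consists of $N$ curves in $\mathbb R^d$ and thereby defines a permutation $\sigma_\alpha$ of $q$, sending the starting point of each curve to its end point. A *Hermitian bundle* over a manifold $Q$ is a smooth complex vector bundle of finite rank over $Q$ with a smooth, positive-definite Hermitian inner product on the fibres and a smooth complex-linear connection for which the inner product is parallel. The *trivial Hermitian bundle* over $Q$ with fibre a finite-dimensional Hilbert space $W$ is $Q\times W$ with the trivial connection. An *isomorphism* of Hermitian bundles $E,E'$ over $Q$ is a family of unitary isomorphisms $I_q:E_q\to E'_q$ $(q\in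 Q)$ such that, for every piecewise smooth curve from $q$ to $r$, the parallel transports of $E$ and $E'$ along it are intertwined by $I_q$ and $I_r$. The pull-back $\hat E$ of a Hermitian bundle $E$ over ${}^N\mathbb R^d$ along $\pi$ has fibres $\hat E_{\hat q}=E_{\pi(\hat q)}$, with the inner products of $E$ and the pull-back connection. The *fermionic line bundle* $F(N,d)$ is the Hermitian line bundle over ${}^N\mathbb R^d$, unique up to isomorphism, whose holonomy along every piecewise smooth loop $\alpha$ is multiplication by the sign $(-1)^{\sigma_\alpha}$ of $\sigma_\alpha$. **Proposition.** For every $N$ and every $d\ge 2$, the pull-back of $F(N,d)$ along $\pi$ is a trivial Hermitian bundle; that is, for every Hermitian line bundle over ${}^N\mathbb R^d$ with holonomies $(-1)^{\sigma_\alpha}$, its pull-back along $\pi$ is isomorphic, as a Hermitian bundle, to the trivial Hermitian bundle $\mathbb R^{d,N}_{\neq}\times\mathbb C$. This includes the case $d=2$, in which (for $N\ge 2$) the covering $\pi$ is not the universal covering of ${}^N\mathbb R^d$. -/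

import Mathlib

set_option linter.unusedSectionVars false
open scoped Manifold ContDiff Topology
open Bundle

universe u v

namespace Conf

/-- The space `(ℝ^d)^N` on which both configuration spaces are modelled. -/
abbrev ConfModel (N d : ℕ) : Type := Fin N → EuclideanSpace ℝ (Fin d)

/-- Ordered non-collision configurations: the open set of `N`-tuples of pairwise distinct points
of `ℝ^d`. -/
def OrderedConf (N d : ℕ) : TopologicalSpace.Opens (ConfModel N d) where
  carrier := {x | Function.Injective x}
  is_open' := by
    have : {x : ConfModel N d | Function.Injective x} =
        ⋂ (j : Fin N) (k : Fin N) (_ : j ≠ k), {x | x j ≠ x k} := by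
      ext x
      simp only [Set.mem_ofPred_eq, Set.mem_iInter]
      exact ⟨fun h j k hjk => h.ne hjk, fun h j k hjk => by_contra fun hne => h j k hne hjk⟩
    rw [this]
    refine isOpen_iInter_of_finite fun j => isOpen_iInter_of_finite fun k =>
      isOpen_iInter_of_finite fun _ => isOpen_ne_fun (by fun_prop) (by fun_prop)

/-- Unordered configurations: the `N`-element subsets of `ℝ^d`. -/
def UnorderedConf (N d : ℕ) : Type := {q : Finset (EuclideanSpace ℝ (Fin d)) // q.card = N}

/-- The covering map `(x₁, …, x_N) ↦ {x₁, …, x_N}`. -/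
def forget (N d : ℕ) (x : OrderedConf N d) : UnorderedConf N d :=
  ⟨Finset.univ.map ⟨x.1, x.2⟩, by simp⟩

/-- The quotient topology. -/
instance (N d : ℕ) : TopologicalSpace (UnorderedConf N d) :=
  TopologicalSpace.coinduced (forget N d) inferInstance

theorem mem_forget {N d : ℕ} {x : OrderedConf N d} {y : EuclideanSpace ℝ (Fin d)} :
    y ∈ (forget N d x).1 ↔ ∃ j, x.1 j = y := by
  refine (Finset.mem_map (f := ⟨x.1, x.2⟩)).trans ?_
  exact ⟨fun ⟨j, _, hj⟩ => ⟨j, hj⟩, fun ⟨j, hj⟩ => ⟨j, Finset.mem_univ _, hj⟩⟩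

/-- The enumeration of the points of `q` given by an ordered configuration `x` over `q`. -/
noncomputable def ordering {N d : ℕ} (x : OrderedConf N d) (q : UnorderedConf N d)
    (h : forget N d x = q) : Fin N ≃ q.1 :=
  Equiv.ofBijective (fun j => ⟨x.1 j, by subst h; exact mem_forget.2 ⟨j, rfl⟩⟩) (by
    subst h
    refine ⟨fun j k hjk => x.2 (congrArg Subtype.val hjk), fun ⟨y, hy⟩ => ?_⟩
    obtain ⟨j, hj⟩ := mem_forget.1 hy
    exact ⟨j, Subtype.ext hj⟩)

theorem forget_surjective (N d : ℕ) : Function.Surjective (forget N d) := by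
  rintro ⟨q, hq⟩
  let e : Fin N ≃ q := (q.equivFinOfCardEq hq).symm
  have he : Function.Injective fun j => (e j : EuclideanSpace ℝ (Fin d)) :=
    Subtype.val_injective.comp e.injective
  refine ⟨⟨fun j => (e j : EuclideanSpace ℝ (Fin d)), he⟩, Subtype.ext (Finset.ext fun y => ?_)⟩
  exact mem_forget.trans ⟨fun ⟨j, hj⟩ => hj ▸ (e j).2, fun hy =>
    ⟨e.symm ⟨y, hy⟩, congrArg Subtype.val (e.apply_symm_apply ⟨y, hy⟩)⟩⟩

instance (N d : ℕ) : MulAction (Equiv.Perm (Fin N)) (OrderedConf N d) where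
  smul τ x := ⟨x.1 ∘ τ.symm, x.2.comp τ.symm.injective⟩
  one_smul _ := rfl
  mul_smul _ _ _ := rfl

instance (N d : ℕ) : ContinuousConstSMul (Equiv.Perm (Fin N)) (OrderedConf N d) where
  continuous_const_smul τ := by
    have h : Continuous fun x : OrderedConf N d => (x.1 ∘ τ.symm : ConfModel N d) :=
      continuous_pi fun j => (continuous_apply (τ.symm j)).comp continuous_subtype_val
    exact h.subtype_mk _

theorem forget_eq_iff {N d : ℕ} {x y : OrderedConf N d} :
    forget N d x = forget N d y ↔ x ∈ MulAction.orbit (Equiv.Perm (Fin N)) y := by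
  constructor
  · intro h
    refine ⟨(ordering y _ rfl).trans (ordering x _ h).symm, Subtype.ext (funext fun j => ?_)⟩
    exact congrArg Subtype.val ((ordering y _ rfl).apply_symm_apply (ordering x _ h j))
  · rintro ⟨τ, rfl⟩
    refine Subtype.ext (Finset.ext fun z => mem_forget.trans (Iff.trans ?_ mem_forget.symm))
    exact ⟨fun ⟨j, hj⟩ => ⟨τ.symm j, hj⟩,
      fun ⟨j, hj⟩ => ⟨τ j, (congrArg y.1 (τ.symm_apply_apply j)).trans hj⟩⟩

theorem isCoveringMap_forget (N d : ℕ) : IsCoveringMap (forget N d) := by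
  have : IsCancelSMul (Equiv.Perm (Fin N)) (OrderedConf N d) := by
    refine ⟨fun τ τ' x h => ?_⟩
    have h' : τ.symm = τ'.symm :=
      Equiv.ext fun j => x.2 (congrFun (congrArg Subtype.val h) j)
    exact Equiv.symm_bijective.injective h'
  have : LocallyCompactSpace (OrderedConf N d) := (OrderedConf N d).isOpen.locallyCompactSpace
  have hq : Topology.IsQuotientMap (forget N d) := ⟨⟨rfl⟩, forget_surjective N d⟩
  exact (hq.isQuotientCoveringMap_of_properlyDiscontinuousSMul
    (G := Equiv.Perm (Fin N)) forget_eq_iff).isCoveringMap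

/-- The charts are the local inverses of the covering map. -/
noncomputable instance (N d : ℕ) : ChartedSpace (ConfModel N d) (UnorderedConf N d) :=
  (isCoveringMap_forget N d).isLocalHomeomorph.chartedSpace (forget_surjective N d)

theorem chart_symm_eq_forget {N d : ℕ} {e : OpenPartialHomeomorph (UnorderedConf N d) (ConfModel N d)}
    (he : e ∈ atlas (ConfModel N d) (UnorderedConf N d)) {z : ConfModel N d} (hz : z ∈ e.target) :
    ∃ h : z ∈ OrderedConf N d, e.symm z = forget N d ⟨z, h⟩ := by
  obtain ⟨q, rfl⟩ := he
  generalize (forget_surjective N d).hasRightInverse.choose q = x at hz ⊢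
  rw [OpenPartialHomeomorph.trans_target] at hz
  obtain ⟨hz, -⟩ := hz
  rw [TopologicalSpace.Opens.chartAt_eq, chartAt_self_eq] at hz ⊢
  have h : z ∈ OrderedConf N d := by
    simpa [OpenPartialHomeomorph.subtypeRestr] using hz
  refine ⟨h, ?_⟩
  rw [OpenPartialHomeomorph.coe_trans_symm, Function.comp_apply, IsLocalHomeomorph.localInverseAt_symm]
  congr 1
  apply Subtype.ext
  have := OpenPartialHomeomorph.subtypeRestr_symm_apply (OpenPartialHomeomorph.refl (ConfModel N d)) ⟨x⟩ hz
  simpa using this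

theorem chart_forget_eq {N d : ℕ} {e : OpenPartialHomeomorph (UnorderedConf N d) (ConfModel N d)}
    (he : e ∈ atlas (ConfModel N d) (UnorderedConf N d)) (x : OrderedConf N d)
    (hx : forget N d x ∈ e.source) :
    ∃ τ : Equiv.Perm (Fin N), x.1 ∘ τ ∈ e.target ∧
      ∀ x' : OrderedConf N d, x'.1 ∘ τ ∈ e.target →
        forget N d x' = e.symm (x'.1 ∘ τ) ∧ e (forget N d x') = x'.1 ∘ τ := by
  obtain ⟨h, h'⟩ := chart_symm_eq_forget he (e.map_source hx)
  rw [e.left_inv hx] at h'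
  obtain ⟨τ, hτ⟩ := forget_eq_iff.1 h'.symm
  have hτ' : x.1 ∘ τ.symm = e (forget N d x) := congrArg Subtype.val hτ
  refine ⟨τ.symm, hτ' ▸ e.map_source hx, fun x' hx' => ?_⟩
  obtain ⟨k, k'⟩ := chart_symm_eq_forget he hx'
  have : forget N d x' = e.symm (x'.1 ∘ τ.symm) := by
    rw [k']
    exact (forget_eq_iff.2 ⟨τ, rfl⟩).symm
  exact ⟨this, by rw [this, e.right_inv hx']⟩

theorem contDiff_permute {N d : ℕ} (τ : Equiv.Perm (Fin N)) :
    ContDiff ℝ ∞ (fun z : ConfModel N d => (z ∘ τ : ConfModel N d)) :=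
  contDiff_pi.2 fun j => contDiff_apply ℝ (EuclideanSpace ℝ (Fin d)) (τ j)

instance (N d : ℕ) : IsManifold 𝓘(ℝ, ConfModel N d) ∞ (UnorderedConf N d) := by
  refine isManifold_of_contDiffOn _ _ _ fun e e' he he' => ?_
  simp only [modelWithCornersSelf_coe, modelWithCornersSelf_coe_symm, Function.comp_id,
    Function.id_comp, Set.preimage_id, Set.range_id, Set.inter_univ]
  intro z hz
  rw [OpenPartialHomeomorph.trans_source, OpenPartialHomeomorph.symm_source] at hz
  obtain ⟨h, h'⟩ := chart_symm_eq_forget he hz.1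
  obtain ⟨τ, hτ, H⟩ := chart_forget_eq he' ⟨z, h⟩ (h' ▸ hz.2)
  refine ContDiffAt.contDiffWithinAt ((contDiff_permute τ).contDiffAt.congr_of_eventuallyEq ?_)
  have h1 : ∀ᶠ w in 𝓝 z, w ∈ e.target := e.open_target.mem_nhds hz.1
  have h2 : ∀ᶠ w in 𝓝 z, (w ∘ τ : ConfModel N d) ∈ e'.target :=
    (contDiff_permute τ).continuous.continuousAt.eventually (e'.open_target.mem_nhds hτ)
  filter_upwards [h1, h2] with w hw hw'
  obtain ⟨k, k'⟩ := chart_symm_eq_forget he hw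
  change e' (e.symm w) = w ∘ τ
  rw [k']
  exact (H ⟨w, k⟩ hw').2

theorem contMDiff_forget (N d : ℕ) :
    ContMDiff 𝓘(ℝ, ConfModel N d) 𝓘(ℝ, ConfModel N d) ∞ (forget N d) := by
  intro x
  let e := chartAt (ConfModel N d) (forget N d x)
  obtain ⟨τ, hτ, H⟩ := chart_forget_eq (chart_mem_atlas _ (forget N d x)) x (mem_chart_source _ _)
  have hg : ContMDiff 𝓘(ℝ, ConfModel N d) 𝓘(ℝ, ConfModel N d) ∞
      (fun x' : OrderedConf N d => (x'.1 ∘ τ : ConfModel N d)) :=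
    (contDiff_permute τ).contMDiff.comp contMDiff_subtype_val
  have hs : ContMDiffAt 𝓘(ℝ, ConfModel N d) 𝓘(ℝ, ConfModel N d) ∞ e.symm (x.1 ∘ τ) :=
    (contMDiffOn_chart_symm (x := forget N d x)).contMDiffAt (e.open_target.mem_nhds hτ)
  refine (hs.comp x hg.contMDiffAt).congr_of_eventuallyEq ?_
  have : ∀ᶠ x' in 𝓝 x, (x'.1 ∘ τ : ConfModel N d) ∈ e.target :=
    hg.continuous.continuousAt.eventually (e.open_target.mem_nhds hτ)
  filter_upwards [this] with x' hx'
  exact (H x' hx').1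

/-- The permutation of the points of `q` induced by a loop `α` at `q`. Lifting `α` to ordered
configurations amounts to writing it as `N` curves in `ℝ^d`; the permutation sends the starting
point of each of these curves to its end point. -/
noncomputable def loopPerm {N d : ℕ} {q : UnorderedConf N d} (α : Path q q) : Equiv.Perm q.1 :=
  let cov := isCoveringMap_forget N d
  let x := (forget_surjective N d q).choose
  have hx : forget N d x = q := (forget_surjective N d q).choose_spec
  have h0 : α.toContinuousMap 0 = forget N d x := α.source.trans hx.symm
  let β := cov.liftPath α.toContinuousMap x h0
  (ordering (β 0) q (by rw [cov.liftPath_zero]; exact hx)).symm.trans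
    (ordering (β 1) q ((congrFun (cov.liftPath_lifts α.toContinuousMap x h0) 1).trans α.target))

/-- The covering map from ordered to unordered configurations, as a smooth map. -/
def forgetMap (N d : ℕ) : C^∞⟮𝓘(ℝ, ConfModel N d), OrderedConf N d;
    𝓘(ℝ, ConfModel N d), UnorderedConf N d⟯ :=
  ⟨forget N d, contMDiff_forget N d⟩

end Conf

namespace Along

section
variable {EB : Type*} [NormedAddCommGroup EB] [NormedSpace ℝ EB]
  {M : Type*} [TopologicalSpace M] [ChartedSpace EB M]
  {EB' : Type*} [NormedAddCommGroup EB'] [NormedSpace ℝ EB']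
  {M' : Type*} [TopologicalSpace M'] [ChartedSpace EB' M']
  {W : Type*} [NormedAddCommGroup W] [NormedSpace ℝ W] [FiniteDimensional ℝ W]
  {V : M → Type*} [TopologicalSpace (TotalSpace W V)]
  [∀ x, NormedAddCommGroup (V x)] [∀ x, NormedSpace ℝ (V x)]
  [FiberBundle W V] [VectorBundle ℝ W V] [ContMDiffVectorBundle 1 W V 𝓘(ℝ, EB)]

noncomputable instance pbN (f : M' → M) (x : M') : NormedAddCommGroup ((f *ᵖ V) x) := inferInstanceAs (NormedAddCommGroup (V (f x)))

noncomputable instance pbS (f : M' → M) (x : M') : NormedSpace ℝ ((f *ᵖ V) x) := inferInstanceAs (NormedSpace ℝ (V (f x)))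

instance pbT (f : M' → M) (x : M') : IsTopologicalAddGroup ((f *ᵖ V) x) := inferInstanceAs (IsTopologicalAddGroup (V (f x)))
instance pbC (f : M' → M) (x : M') : ContinuousSMul ℝ ((f *ᵖ V) x) := inferInstanceAs (ContinuousSMul ℝ (V (f x)))

variable (W) in
/-- The fibre coordinate, in the trivialization at `b`, of a section `s` along `f : M' → M`. -/
noncomputable def coordOf (f : M' → M) (b : M) (s : Π x : M', V (f x)) (y : M') : W :=
  (trivializationAt W V b ⟨f y, s y⟩).2

theorem mdiff_pb (f : C^∞⟮𝓘(ℝ, EB'), M'; 𝓘(ℝ, EB), M⟯) (s : Π x : M', (f *ᵖ V) x) (x : M') :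
   MDifferentiableAt 𝓘(ℝ, EB') (𝓘(ℝ, EB').prod 𝓘(ℝ, W)) (fun y => TotalSpace.mk' W (E := f *ᵖ V) y (s y)) x ↔
   MDifferentiableAt 𝓘(ℝ, EB') (𝓘(ℝ, W)) (coordOf W f (f x) s) x := by
  rw [mdifferentiableAt_section]
  rfl

theorem baseSet_ev {f : M' → M} (x : M') (hf : ContinuousAt f x) :
    ∀ᶠ y in 𝓝 x, f y ∈ (trivializationAt W V (f x)).baseSet :=
  hf.eventually ((trivializationAt W V (f x)).open_baseSet.mem_nhds (mem_baseSet_trivializationAt W V (f x)))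

theorem coordOf_add {f : M' → M} (x : M') (hf : ContinuousAt f x) (s t : Π x : M', V (f x)) :
    coordOf W f (f x) (s + t) =ᶠ[𝓝 x] coordOf W f (f x) s + coordOf W f (f x) t := by
  filter_upwards [baseSet_ev (W := W) (V := V) x hf] with y hy
  exact ((trivializationAt W V (f x)).linear ℝ hy).map_add (s y) (t y)

theorem coordOf_smul {f : M' → M} (x : M') (hf : ContinuousAt f x) (g : M' → ℝ) (s : Π x : M', V (f x)) :
    coordOf W f (f x) (g • s) =ᶠ[𝓝 x] g • coordOf W f (f x) s := by
  filter_upwards [baseSet_ev (W := W) (V := V) x hf] with y hy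
  exact ((trivializationAt W V (f x)).linear ℝ hy).map_smul (g y) (s y)

theorem symmL_coordOf {f : M' → M} (x : M') (s : Π x : M', V (f x)) :
    (trivializationAt W V (f x)).symmL ℝ (f x) (coordOf W f (f x) s x) = s x := by
  have := (trivializationAt W V (f x)).symmL_continuousLinearMapAt (R := ℝ)
     (mem_baseSet_trivializationAt W V (f x)) (s x)
  rwa [Trivialization.continuousLinearMapAt_apply, Trivialization.linearMapAt_apply, if_pos (mem_baseSet_trivializationAt W V (f x))] at this

theorem mvfderiv_congr {f g : M' → W} {x : M'} (h : f =ᶠ[𝓝 x] g) : mvfderiv 𝓘(ℝ, EB') f x = mvfderiv 𝓘(ℝ, EB') g x := by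
  ext v
  have h1 := h.mfderiv_eq (I := 𝓘(ℝ, EB')) (I' := 𝓘(ℝ, W))
  exact congrArg (fun L : EB' →L[ℝ] W => L v) h1

variable (W) in
/-- The derivative at `x` of a section along `f`, taken in the trivialization at `f x`. -/
noncomputable def dCoord (f : M' → M) (s : Π x : M', V (f x)) (x : M') : TangentSpace 𝓘(ℝ, EB') x →L[ℝ] V (f x) :=
  ((trivializationAt W V (f x)).symmL ℝ (f x)).comp (mvfderiv 𝓘(ℝ, EB') (coordOf W f (f x) s) x)

theorem dCoord_add {f : M' → M} {x : M'} (hf : ContinuousAt f x) {s t : Π x : M', V (f x)}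
    (hs : MDifferentiableAt 𝓘(ℝ, EB') (𝓘(ℝ, W)) (coordOf W f (f x) s) x)
    (ht : MDifferentiableAt 𝓘(ℝ, EB') (𝓘(ℝ, W)) (coordOf W f (f x) t) x) :
    dCoord (EB' := EB') W f (s + t) x = dCoord W f s x + dCoord W f t x := by
  unfold dCoord
  rw [mvfderiv_congr (coordOf_add x hf s t), mvfderiv_add hs ht, ContinuousLinearMap.comp_add]

theorem dCoord_smul {f : M' → M} {x : M'} (hf : ContinuousAt f x) {g : M' → ℝ} {s : Π x : M', V (f x)}
    (hg : MDifferentiableAt 𝓘(ℝ, EB') 𝓘(ℝ, ℝ) g x)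
    (hs : MDifferentiableAt 𝓘(ℝ, EB') (𝓘(ℝ, W)) (coordOf W f (f x) s) x) :
    dCoord (EB' := EB') W f (g • s) x = g x • dCoord W f s x + (mvfderiv 𝓘(ℝ, EB') g x).smulRight (s x) := by
  unfold dCoord
  rw [mvfderiv_congr (coordOf_smul x hf g s), mvfderiv_smul hg hs]
  ext v
  simp [symmL_coordOf]

theorem extend_eq {b : M} (v : V b) {y : M} (hy : y ∈ (trivializationAt W V b).baseSet) :
    FiberBundle.extend W v y =
      (trivializationAt W V b).symmL ℝ y (trivializationAt W V b ⟨b, v⟩).2 :=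
  (Trivialization.symmL_apply _ hy _).symm

theorem cov_extend_add (cov : CovariantDerivative 𝓘(ℝ, EB) W V) {b : M} (v w : V b) :
    cov (FiberBundle.extend W (v + w)) b =
      cov (FiberBundle.extend W v) b + cov (FiberBundle.extend W w) b := by
  have hv := FiberBundle.mdifferentiableAt_extend 𝓘(ℝ, EB) W v
  have hw := FiberBundle.mdifferentiableAt_extend 𝓘(ℝ, EB) W w
  rw [← cov.isCovariantDerivativeOnUniv.add hv hw]
  refine cov.isCovariantDerivativeOnUniv.congr_of_eventuallyEq
    (FiberBundle.mdifferentiableAt_extend ..) (mdifferentiableAt_add_section hv hw)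
    Filter.univ_mem ?_
  filter_upwards [(trivializationAt W V b).open_baseSet.mem_nhds
    (mem_baseSet_trivializationAt W V b)] with y hy
  have h := ((trivializationAt W V b).linear ℝ (mem_baseSet_trivializationAt W V b)).map_add v w
  rw [Pi.add_apply, extend_eq _ hy, extend_eq _ hy, extend_eq _ hy, h, map_add]

theorem cov_extend_smul (cov : CovariantDerivative 𝓘(ℝ, EB) W V) {b : M} (c : ℝ) (v : V b) :
    cov (FiberBundle.extend W (c • v)) b = c • cov (FiberBundle.extend W v) b := by
  have hv := FiberBundle.mdifferentiableAt_extend 𝓘(ℝ, EB) W v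
  rw [← cov.isCovariantDerivativeOnUniv.smul_const c hv]
  refine cov.isCovariantDerivativeOnUniv.congr_of_eventuallyEq
    (FiberBundle.mdifferentiableAt_extend ..) (mdifferentiableAt_const.smul_section hv)
    Filter.univ_mem ?_
  filter_upwards [(trivializationAt W V b).open_baseSet.mem_nhds
    (mem_baseSet_trivializationAt W V b)] with y hy
  have h := ((trivializationAt W V b).linear ℝ (mem_baseSet_trivializationAt W V b)).map_smul c v
  rw [Pi.smul_apply, extend_eq _ hy, extend_eq _ hy, h, map_smul]


variable (W V) in
/-- Differentiability at `x` of a section `s` along `f`. -/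
def MDC (EB' : Type*) [NormedAddCommGroup EB'] [NormedSpace ℝ EB'] [ChartedSpace EB' M'] (f : M' → M) (s : Π x : M', V (f x)) (x : M') : Prop :=
  MDifferentiableAt 𝓘(ℝ, EB') (𝓘(ℝ, W)) (coordOf W f (f x) s) x

theorem MDC.add {f : M' → M} {x : M'} (hf : ContinuousAt f x) {s t : Π x : M', V (f x)}
    (hs : MDC W V EB' f s x) (ht : MDC W V EB' f t x) : MDC W V EB' f (s + t) x :=
  (MDifferentiableAt.add hs ht).congr_of_eventuallyEq (coordOf_add x hf s t)

theorem MDC.smul {f : M' → M} {x : M'} (hf : ContinuousAt f x) {g : M' → ℝ} {s : Π x : M', V (f x)}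
    (hg : MDifferentiableAt 𝓘(ℝ, EB') 𝓘(ℝ, ℝ) g x)
    (hs : MDC W V EB' f s x) : MDC W V EB' f (g • s) x :=
  (MDifferentiableAt.smul hg hs).congr_of_eventuallyEq (coordOf_smul x hf g s)

/-- The covariant derivative of a section `s` along a map `f : M' → M`: the operator which is
additive, satisfies the Leibniz rule and takes `σ ∘ f` to `∇σ ∘ df` (`alongCov_add`,
`alongCov_smul`, `alongCov_comp`). -/
noncomputable def alongCov (f : M' → M) (cov : CovariantDerivative 𝓘(ℝ, EB) W V)
    (s : Π x : M', V (f x)) (x : M') : TangentSpace 𝓘(ℝ, EB') x →L[ℝ] V (f x) :=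
  dCoord (EB' := EB') W f s x + (cov (FiberBundle.extend W (s x)) (f x)).comp (mfderiv 𝓘(ℝ, EB') 𝓘(ℝ, EB) f x)

theorem alongCov_add (cov : CovariantDerivative 𝓘(ℝ, EB) W V) {f : M' → M} {x : M'} (hf : ContinuousAt f x)
    {s t : Π x : M', V (f x)} (hs : MDC W V EB' f s x) (ht : MDC W V EB' f t x) :
    alongCov (EB' := EB') f cov (s + t) x = alongCov f cov s x + alongCov f cov t x := by
  have h1 := dCoord_add hf hs ht
  have h2 := congrArg (fun L => L.comp (mfderiv 𝓘(ℝ, EB') 𝓘(ℝ, EB) f x)) (cov_extend_add cov (b := f x) (s x) (t x))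
  refine (congrArg₂ (· + ·) h1 h2).trans ?_
  rw [ContinuousLinearMap.add_comp]
  exact add_add_add_comm ..

theorem alongCov_smul (cov : CovariantDerivative 𝓘(ℝ, EB) W V) {f : M' → M} {x : M'} (hf : ContinuousAt f x)
    {g : M' → ℝ} {s : Π x : M', V (f x)} (hg : MDifferentiableAt 𝓘(ℝ, EB') 𝓘(ℝ, ℝ) g x) (hs : MDC W V EB' f s x) :
    alongCov (EB' := EB') f cov (g • s) x = g x • alongCov f cov s x + (mvfderiv 𝓘(ℝ, EB') g x).smulRight (s x) := by
  have h1 := dCoord_smul hf hg hs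
  have h2 := congrArg (fun L => L.comp (mfderiv 𝓘(ℝ, EB') 𝓘(ℝ, EB) f x)) (cov_extend_smul cov (b := f x) (g x) (s x))
  refine (congrArg₂ (· + ·) h1 h2).trans ?_
  rw [ContinuousLinearMap.smul_comp]
  exact (add_right_comm _ _ _).trans (congrArg₂ (· + ·) (smul_add _ _ _).symm rfl)

theorem alongCov_congr (cov : CovariantDerivative 𝓘(ℝ, EB) W V) {f : M' → M} {x : M'}
    {s t : Π x : M', V (f x)} (h : ∀ᶠ y in 𝓝 x, s y = t y) :
    alongCov (EB' := EB') f cov s x = alongCov f cov t x := by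
  have h1 : coordOf W f (f x) s =ᶠ[𝓝 x] coordOf W f (f x) t := by
    filter_upwards [h] with y hy
    simp only [coordOf, hy]
  unfold alongCov dCoord
  rw [mvfderiv_congr h1, h.self_of_nhds]

theorem MDC.congr {f : M' → M} {x : M'} {s t : Π x : M', V (f x)} (hs : MDC W V EB' f s x)
    (h : ∀ᶠ y in 𝓝 x, t y = s y) : MDC W V EB' f t x := by
  have h1 : coordOf W f (f x) t =ᶠ[𝓝 x] coordOf W f (f x) s := by
    filter_upwards [h] with y hy
    simp only [coordOf, hy]
  exact MDifferentiableAt.congr_of_eventuallyEq hs h1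

/-- The pull-back connection. -/
noncomputable def pullbackConn (f : C^∞⟮𝓘(ℝ, EB'), M'; 𝓘(ℝ, EB), M⟯) (cov : CovariantDerivative 𝓘(ℝ, EB) W V) :
    CovariantDerivative 𝓘(ℝ, EB') W (f *ᵖ V) where
  toFun s x := alongCov f cov s x
  isCovariantDerivativeOnUniv := by
    constructor
    · intro s t x hs ht _
      exact alongCov_add cov f.contMDiff.continuous.continuousAt ((mdiff_pb f s x).1 hs) ((mdiff_pb f t x).1 ht)
    · intro s g x hs hg _
      exact alongCov_smul cov f.contMDiff.continuous.continuousAt hg ((mdiff_pb f s x).1 hs)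

theorem mdiff_base (σ : Π x : M, V x) (x : M) :
   MDifferentiableAt 𝓘(ℝ, EB) (𝓘(ℝ, EB).prod 𝓘(ℝ, W)) (fun y => TotalSpace.mk' W (E := V) y (σ y)) x ↔
   MDifferentiableAt 𝓘(ℝ, EB) (𝓘(ℝ, W)) (coordOf W id x σ) x := by
  rw [mdifferentiableAt_section]
  rfl

theorem dCoord_extend {b : M} (v : V b) : dCoord (EB' := EB) W id (FiberBundle.extend W v) b = 0 := by
  unfold dCoord
  have : coordOf W id b (FiberBundle.extend W v) =ᶠ[𝓝 b] fun _ => (trivializationAt W V b ⟨b, v⟩).2 := by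
    filter_upwards [baseSet_ev (W := W) (V := V) (f := id) b continuousAt_id] with y hy
    have h := congrArg Prod.snd ((trivializationAt W V b).apply_mk_symm hy (trivializationAt W V b ⟨b, v⟩).2)
    simp only [FiberBundle.extend, coordOf] at h ⊢
    exact h
  change ContinuousLinearMap.comp _ (mvfderiv _ (coordOf W id b _) b) = 0
  rw [mvfderiv_congr this, mvfderiv_const]
  exact ContinuousLinearMap.comp_zero _

theorem cov_eq_dCoord_add (cov : CovariantDerivative 𝓘(ℝ, EB) W V) {σ : Π x : M, V x} {b : M}
    (hσ : MDifferentiableAt 𝓘(ℝ, EB) (𝓘(ℝ, EB).prod 𝓘(ℝ, W)) (fun y => TotalSpace.mk' W (E := V) y (σ y)) b) :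
    cov σ b = dCoord W id σ b + cov (FiberBundle.extend W (σ b)) b := by
  have hT : TensorialAt 𝓘(ℝ, EB) W (fun σ : Π x : M, V x => cov σ b - dCoord W id σ b) b := by
    constructor
    · intro g σ hg hσ
      have h1 := dCoord_smul (f := id) continuousAt_id hg ((mdiff_base σ b).1 hσ)
      have h2 := cov.isCovariantDerivativeOnUniv.leibniz hσ hg
      rw [h1, h2, smul_sub]
      exact add_sub_add_right_eq_sub _ _ _
    · intro σ τ hσ hτ
      have h1 := dCoord_add (f := id) continuousAt_id ((mdiff_base σ b).1 hσ) ((mdiff_base τ b).1 hτ)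
      have h2 := cov.isCovariantDerivativeOnUniv.add hσ hτ
      rw [h1, h2]
      exact add_sub_add_comm _ _ _ _
  have := hT.pointwise hσ (FiberBundle.mdifferentiableAt_extend 𝓘(ℝ, EB) W (σ b)) (by simp)
  simp only [dCoord_extend, sub_zero] at this
  rw [← this]
  exact (add_sub_cancel _ _).symm

theorem MDC.comp {f : M' → M} {x : M'} (hf : MDifferentiableAt 𝓘(ℝ, EB') 𝓘(ℝ, EB) f x) {σ : Π x : M, V x}
    (hσ : MDifferentiableAt 𝓘(ℝ, EB) (𝓘(ℝ, EB).prod 𝓘(ℝ, W)) (fun y => TotalSpace.mk' W (E := V) y (σ y)) (f x)) :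
    MDC W V EB' f (fun y => σ (f y)) x :=
  MDifferentiableAt.comp (g := coordOf W id (f x) σ) x ((mdiff_base σ (f x)).1 hσ) hf

theorem alongCov_comp (cov : CovariantDerivative 𝓘(ℝ, EB) W V) {f : M' → M} {x : M'}
   (hf : MDifferentiableAt 𝓘(ℝ, EB') 𝓘(ℝ, EB) f x) {σ : Π x : M, V x}
   (hσ : MDifferentiableAt 𝓘(ℝ, EB) (𝓘(ℝ, EB).prod 𝓘(ℝ, W)) (fun y => TotalSpace.mk' W (E := V) y (σ y)) (f x)) :
   alongCov f cov (fun y => σ (f y)) x = (cov σ (f x)).comp (mfderiv 𝓘(ℝ, EB') 𝓘(ℝ, EB) f x) := by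
  rw [cov_eq_dCoord_add cov hσ, ContinuousLinearMap.add_comp]
  have h1 : mvfderiv 𝓘(ℝ, EB') (coordOf W f (f x) (fun y => σ (f y))) x = (mvfderiv 𝓘(ℝ, EB) (coordOf W id (f x) σ) (f x)).comp (mfderiv 𝓘(ℝ, EB') 𝓘(ℝ, EB) f x) :=
    mfderiv_comp (g := coordOf W id (f x) σ) x ((mdiff_base σ (f x)).1 hσ) hf
  unfold alongCov dCoord
  rw [h1]
  rfl

variable (W V) in
/-- The local frame given by the trivialization at `b`. -/
noncomputable def frm (b : M) (i : Fin (Module.finrank ℝ W)) : Π x, V x :=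
  (trivializationAt W V b).localFrame (Module.finBasis ℝ W) i

theorem frm_apply {b y : M} (hy : y ∈ (trivializationAt W V b).baseSet) (i) :
    frm W V b i y = (trivializationAt W V b).symmL ℝ y (Module.finBasis ℝ W i) := by
  rw [frm, Trivialization.localFrame_apply_of_mem_baseSet _ _ hy]
  simp only [Trivialization.basisAt, Module.Basis.map_apply, Trivialization.symmL_apply _ hy]
  rfl

theorem triv_frm {b y : M} (hy : y ∈ (trivializationAt W V b).baseSet) (i) :
    (trivializationAt W V b ⟨y, frm W V b i y⟩).2 = Module.finBasis ℝ W i := by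
  rw [frm_apply hy]
  have := (trivializationAt W V b).continuousLinearMapAt_symmL (R := ℝ) hy (Module.finBasis ℝ W i)
  rwa [Trivialization.continuousLinearMapAt_apply, Trivialization.linearMapAt_apply, if_pos hy] at this

/-- The coordinate functionals of the model fibre. -/
noncomputable def cf (i : Fin (Module.finrank ℝ W)) : W →L[ℝ] ℝ :=
  LinearMap.toContinuousLinearMap ((Module.finBasis ℝ W).coord i)

theorem eq_sum_frm {b y : M} (hy : y ∈ (trivializationAt W V b).baseSet) (v : V y) :
    v = ∑ i, cf i (trivializationAt W V b ⟨y, v⟩).2 • frm W V b i y := by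
  have := (trivializationAt W V b).symmL_continuousLinearMapAt (R := ℝ) hy v
  rw [Trivialization.continuousLinearMapAt_apply, Trivialization.linearMapAt_apply, if_pos hy] at this
  conv_lhs => rw [← this, ← (Module.finBasis ℝ W).sum_repr (trivializationAt W V b ⟨y, v⟩).2]
  simp only [map_sum, map_smul, frm_apply hy]
  rfl

theorem mdiff_frm {b y : M} (hy : y ∈ (trivializationAt W V b).baseSet) (i) :
    MDifferentiableAt 𝓘(ℝ, EB) (𝓘(ℝ, EB).prod 𝓘(ℝ, W)) (fun y => TotalSpace.mk' W (E := V) y (frm W V b i y)) y :=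
  (contMDiffAt_localFrame_of_mem 1 _ _ i hy).mdifferentiableAt (by simp)

/-- Every differentiable section along `f` is a combination of sections `σ ∘ f`. -/
theorem MDC.induction {f : M' → M} {x : M'} (hf : MDifferentiableAt 𝓘(ℝ, EB') 𝓘(ℝ, EB) f x)
    {P : (Π x : M', V (f x)) → Prop}
    (hP : ∀ s t : Π x : M', V (f x), (∀ᶠ y in 𝓝 x, s y = t y) → MDC W V EB' f s x → P s → P t)
    (hadd : ∀ s t : Π x : M', V (f x), MDC W V EB' f s x → MDC W V EB' f t x → P s → P t → P (s + t))
    (hsmul : ∀ (g : M' → ℝ) (s : Π x : M', V (f x)), MDifferentiableAt 𝓘(ℝ, EB') 𝓘(ℝ, ℝ) g x → MDC W V EB' f s x → P s → P (g • s))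
    (hcomp : ∀ σ : Π x, V x, MDifferentiableAt 𝓘(ℝ, EB) (𝓘(ℝ, EB).prod 𝓘(ℝ, W)) (fun y => TotalSpace.mk' W (E := V) y (σ y)) (f x) →
      P (fun y => σ (f y)))
    (s : Π x : M', V (f x)) (hs : MDC W V EB' f s x) : P s := by
  have hb := mem_baseSet_trivializationAt W V (f x)
  have h0 : MDifferentiableAt 𝓘(ℝ, EB) (𝓘(ℝ, EB).prod 𝓘(ℝ, W)) (fun y => TotalSpace.mk' W (E := V) y ((0 : Π x, V x) y)) (f x) :=
    mdifferentiableAt_zeroSection ℝ V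
  have key : ∀ t : Finset (Fin (Module.finrank ℝ W)),
      MDC W V EB' f (∑ i ∈ t, (fun y => cf i (coordOf W f (f x) s y)) • (fun y => frm W V (f x) i (f y))) x ∧
      P (∑ i ∈ t, (fun y => cf i (coordOf W f (f x) s y)) • (fun y => frm W V (f x) i (f y))) := by
    intro t
    induction t using Finset.induction_on with
    | empty => exact ⟨MDC.comp hf h0, hcomp _ h0⟩
    | insert i t hi ih =>
      rw [Finset.sum_insert hi]
      have h1 := MDC.comp hf (mdiff_frm hb i)
      have h2 : MDifferentiableAt 𝓘(ℝ, EB') 𝓘(ℝ, ℝ) (fun y => cf i (coordOf W f (f x) s y)) x :=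
        ((cf i).mdifferentiableAt (x := coordOf W f (f x) s x)).comp x hs
      have h3 := MDC.smul hf.continuousAt h2 h1
      exact ⟨h3.add hf.continuousAt ih.1, hadd _ _ h3 ih.1 (hsmul _ _ h2 h1 (hcomp _ (mdiff_frm hb i))) ih.2⟩
  refine hP _ _ ?_ (key Finset.univ).1 (key Finset.univ).2
  filter_upwards [baseSet_ev (W := W) (V := V) x hf.continuousAt] with y hy
  rw [Finset.sum_apply]
  exact (eq_sum_frm hy (s y)).symm

section smooth
variable [IsManifold 𝓘(ℝ, EB) ∞ M] [IsManifold 𝓘(ℝ, EB') ∞ M'] [ContMDiffVectorBundle ∞ W V 𝓘(ℝ, EB)]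
open ContinuousLinearMap in
theorem alongCov_contMDiffAt (cov : CovariantDerivative 𝓘(ℝ, EB) W V)
    (hc : ∀ u : Set M, IsOpen u → ContMDiffCovariantDerivativeOn W ∞ cov u)
    {f : M' → M} (hf : ContMDiff 𝓘(ℝ, EB') 𝓘(ℝ, EB) ∞ f) {x₀ : M'} {s : Π x : M', V (f x)}
    (hs : ContMDiffAt 𝓘(ℝ, EB') 𝓘(ℝ, W) ∞ (coordOf W f (f x₀) s) x₀) :
    ContMDiffAt 𝓘(ℝ, EB') 𝓘(ℝ, EB' →L[ℝ] W) ∞ (fun y => inCoordinates EB' (TangentSpace 𝓘(ℝ, EB') : M' → Type _) W V x₀ y (f x₀) (f y) (alongCov f cov s y)) x₀ := by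
  set A : Fin (Module.finrank ℝ W) → M' → ℝ := fun i y => cf i (coordOf W f (f x₀) s y) with hA
  have hAs : ∀ i, ContMDiffAt 𝓘(ℝ, EB') 𝓘(ℝ, ℝ) ∞ (A i) x₀ := fun i =>
    (cf i).contMDiff.contMDiffAt.comp x₀ hs
  have hev := baseSet_ev (W := W) (V := V) x₀ hf.continuous.continuousAt
  have hfd : ∀ y, MDifferentiableAt 𝓘(ℝ, EB') 𝓘(ℝ, EB) f y := fun y => (hf y).mdifferentiableAt (by simp)
  have hmodel : ContMDiffAt 𝓘(ℝ, EB') 𝓘(ℝ, EB' →L[ℝ] W) ∞ (fun y => ∑ i,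
      ((inTangentCoordinates 𝓘(ℝ, EB') 𝓘(ℝ, ℝ) id (A i) (fun y => mfderiv 𝓘(ℝ, EB') 𝓘(ℝ, ℝ) (A i) y) x₀ y).smulRight (Module.finBasis ℝ W i)
       + A i y • (inCoordinates EB (TangentSpace 𝓘(ℝ, EB) : M → Type _) W V (f x₀) (f y) (f x₀) (f y) (cov (frm W V (f x₀) i) (f y))).comp
          (inTangentCoordinates 𝓘(ℝ, EB') 𝓘(ℝ, EB) id f (fun y => mfderiv 𝓘(ℝ, EB') 𝓘(ℝ, EB) f y) x₀ y))) x₀ := by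
    refine ContMDiffAt.sum fun i _ => ContMDiffAt.add ?_ ?_
    · have h1 := (hAs i).mfderiv_const (m := ∞) (by simp)
      exact ((smulRightL ℝ EB' W).flip (Module.finBasis ℝ W i)).contMDiff.contMDiffAt.comp x₀ h1
    · refine (hAs i).smul ?_
      have h1 := (hf x₀).mfderiv_const (m := ∞) (by simp)
      have h2 := (hc _ (trivializationAt W V (f x₀)).open_baseSet).contMDiff (σ := frm W V (f x₀) i)
        (by exact Trivialization.contMDiffOn_localFrame_baseSet ∞ (trivializationAt W V (f x₀)) (Module.finBasis ℝ W) i)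
      have h3 := h2.contMDiffAt ((trivializationAt W V (f x₀)).open_baseSet.mem_nhds (mem_baseSet_trivializationAt W V (f x₀)))
      rw [contMDiffAt_hom_bundle] at h3
      exact (h3.2.comp x₀ (hf x₀)).clm_comp h1
  refine hmodel.congr_of_eventuallyEq ?_
  have hAev : ∀ᶠ y in 𝓝 x₀, ∀ i, MDifferentiableAt 𝓘(ℝ, EB') 𝓘(ℝ, ℝ) (A i) y := by
    rw [Filter.eventually_all]
    intro i
    have h1 : ContMDiffAt 𝓘(ℝ, EB') 𝓘(ℝ, ℝ) ((1 : ℕ) : WithTop ℕ∞) (A i) x₀ := (hAs i).of_le (by exact_mod_cast le_top)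
    filter_upwards [(contMDiffAt_iff_contMDiffAt_nhds (by simp)).1 h1] with y hy
    exact hy.mdifferentiableAt (by simp)
  have ht : ∀ᶠ y in 𝓝 x₀, y ∈ (trivializationAt EB' (TangentSpace 𝓘(ℝ, EB') : M' → Type _) x₀).baseSet :=
    (trivializationAt EB' (TangentSpace 𝓘(ℝ, EB') : M' → Type _) x₀).open_baseSet.mem_nhds (mem_baseSet_trivializationAt EB' (TangentSpace 𝓘(ℝ, EB') : M' → Type _) x₀)
  have ht2 : ∀ᶠ y in 𝓝 x₀, f y ∈ (trivializationAt EB (TangentSpace 𝓘(ℝ, EB) : M → Type _) (f x₀)).baseSet :=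
    hf.continuous.continuousAt.eventually ((trivializationAt EB (TangentSpace 𝓘(ℝ, EB) : M → Type _) (f x₀)).open_baseSet.mem_nhds (mem_baseSet_trivializationAt EB (TangentSpace 𝓘(ℝ, EB) : M → Type _) (f x₀)))
  filter_upwards [hev, hev.eventually_nhds, hAev, ht, ht2] with y hy hyev hAy hty hty2
  have hfc : ContinuousAt f y := hf.continuous.continuousAt
  have key : ∀ t : Finset (Fin (Module.finrank ℝ W)),
      MDC W V EB' f (∑ i ∈ t, A i • (fun y => frm W V (f x₀) i (f y))) y ∧
      alongCov (EB' := EB') f cov (∑ i ∈ t, A i • (fun y => frm W V (f x₀) i (f y))) y =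
       ∑ i ∈ t, (A i y • (cov (frm W V (f x₀) i) (f y)).comp (mfderiv 𝓘(ℝ, EB') 𝓘(ℝ, EB) f y) +
        (mvfderiv 𝓘(ℝ, EB') (A i) y).smulRight (frm W V (f x₀) i (f y))) := by
    intro t
    induction t using Finset.induction_on with
    | empty =>
      have h0 : MDifferentiableAt 𝓘(ℝ, EB) (𝓘(ℝ, EB).prod 𝓘(ℝ, W)) (fun y => TotalSpace.mk' W (E := V) y ((0 : Π x, V x) y)) (f y) :=
        mdifferentiableAt_zeroSection ℝ V
      refine ⟨MDC.comp (hfd y) h0, (alongCov_comp cov (hfd y) h0).trans ?_⟩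
      rw [cov.zero]
      exact ContinuousLinearMap.zero_comp _
    | insert i t hi ih =>
      have h1 := MDC.comp (hfd y) (mdiff_frm hy i)
      have h3 := MDC.smul hfc (hAy i) h1
      rw [Finset.sum_insert hi, Finset.sum_insert hi]
      refine ⟨h3.add hfc ih.1, ?_⟩
      rw [alongCov_add cov hfc h3 ih.1, alongCov_smul cov hfc (hAy i) h1, alongCov_comp cov (hfd y) (mdiff_frm hy i), ih.2]
  have hsy : alongCov (EB' := EB') f cov s y = _ := (alongCov_congr cov ?_).trans (key Finset.univ).2
  swap
  · filter_upwards [hyev] with z hz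
    rw [Finset.sum_apply]
    exact eq_sum_frm hz (s z)
  rw [hsy]
  ext v
  simp only [inCoordinates, inTangentCoordinates, ContinuousLinearMap.comp_apply, _root_.sum_apply, map_sum]
  refine Finset.sum_congr rfl fun i _ => ?_
  simp only [_root_.add_apply, map_add, _root_.smul_apply, map_smul, ContinuousLinearMap.smulRight_apply, ContinuousLinearMap.comp_apply]
  rw [add_comm]
  congr 1
  · rw [Trivialization.continuousLinearMapAt_apply, Trivialization.linearMapAt_apply, if_pos hy, triv_frm hy]
    refine congrArg (· • _) ?_
    have h := TangentBundle.continuousLinearMapAt_model_space (𝕜 := ℝ) (A i x₀) (A i y)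
    exact (congrArg (fun L : ℝ →L[ℝ] ℝ => L (mvfderiv 𝓘(ℝ, EB') (A i) y
      ((trivializationAt EB' (TangentSpace 𝓘(ℝ, EB') : M' → Type _) x₀).symmL ℝ y v))) h).symm
  · have := (trivializationAt EB (TangentSpace 𝓘(ℝ, EB) : M → Type _) (f x₀)).symmL_continuousLinearMapAt (R := ℝ) hty2
      (mfderiv 𝓘(ℝ, EB') 𝓘(ℝ, EB) f y ((trivializationAt EB' (TangentSpace 𝓘(ℝ, EB') : M' → Type _) x₀).symmL ℝ y v))
    rw [← this]
    rfl
end smooth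

section complex
variable {W : Type*} [NormedAddCommGroup W] [NormedSpace ℂ W] [FiniteDimensional ℂ W]
  {V : M → Type*} [TopologicalSpace (TotalSpace W V)]
  [∀ x, NormedAddCommGroup (V x)] [∀ x, InnerProductSpace ℂ (V x)]
  [FiberBundle W V] [VectorBundle ℂ W V] [VectorBundle ℝ W V] [ContMDiffVectorBundle 1 W V 𝓘(ℝ, EB)]

theorem coordOf_csmul {f : M' → M} (x : M') (hf : ContinuousAt f x) (c : ℂ) (s : Π x : M', V (f x)) :
    coordOf W f (f x) (c • s) =ᶠ[𝓝 x] c • coordOf W f (f x) s := by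
  filter_upwards [baseSet_ev (W := W) (V := V) x hf] with y hy
  exact ((trivializationAt W V (f x)).linear ℂ hy).map_smul c (s y)

theorem MDC.csmul {f : M' → M} {x : M'} (hf : ContinuousAt f x) (c : ℂ) {s : Π x : M', V (f x)}
    (hs : MDC W V EB' f s x) : MDC W V EB' f (c • s) x := by
  have h : MDifferentiableAt 𝓘(ℝ, EB') 𝓘(ℝ, W) (fun y => (c • ContinuousLinearMap.id ℝ W) (coordOf W f (f x) s y)) x :=
    (ContinuousLinearMap.mdifferentiableAt (c • ContinuousLinearMap.id ℝ W)).comp x hs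
  exact h.congr_of_eventuallyEq (coordOf_csmul x hf c s)

theorem alongCov_csmul (cov : CovariantDerivative 𝓘(ℝ, EB) W V)
    (hc : ∀ (c : ℂ) (σ : Π x, V x) (x : M),
      MDifferentiableAt 𝓘(ℝ, EB) (𝓘(ℝ, EB).prod 𝓘(ℝ, W)) (fun y => TotalSpace.mk' W (E := V) y (σ y)) x →
      cov (c • σ) x = c • cov σ x)
    {f : M' → M} {x : M'}
    (hf : MDifferentiableAt 𝓘(ℝ, EB') 𝓘(ℝ, EB) f x) (c : ℂ) {s : Π x : M', V (f x)} (hs : MDC W V EB' f s x) :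
    alongCov (EB' := EB') f cov (c • s) x = c • alongCov f cov s x := by
  have hfc := hf.continuousAt
  refine MDC.induction (P := fun s => alongCov (EB' := EB') f cov (c • s) x = c • alongCov f cov s x) hf ?_ ?_ ?_ ?_ s hs
  · intro s t h _ hs
    rw [← alongCov_congr cov h, ← hs]
    exact alongCov_congr cov (h.mono fun y hy => congrArg (c • ·) hy.symm)
  · intro s t h1 h2 e1 e2
    rw [smul_add, alongCov_add cov hfc (h1.csmul hfc c) (h2.csmul hfc c), e1, e2, alongCov_add cov hfc h1 h2, smul_add]
  · intro g s hg h1 e1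
    have : c • (g • s) = g • (c • s) := by
      funext y; exact smul_comm c (g y) (s y)
    rw [this, alongCov_smul cov hfc hg (h1.csmul hfc c), e1, alongCov_smul cov hfc hg h1, smul_add]
    congr 1
    · exact smul_comm _ _ _
    · ext v
      exact smul_comm _ _ _
  · intro σ hσ
    have h2 : MDifferentiableAt 𝓘(ℝ, EB) (𝓘(ℝ, EB).prod 𝓘(ℝ, W)) (fun y => TotalSpace.mk' W (E := V) y ((c • σ) y)) (f x) := by
      refine (mdiff_base _ _).2 ?_
      exact MDC.csmul (f := id) continuousAt_id c ((mdiff_base _ _).1 hσ)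
    have h3 := alongCov_comp cov hf h2
    have h4 := alongCov_comp cov hf hσ
    rw [h4]
    refine h3.trans ?_
    rw [hc c σ _ hσ]
    rfl


/-- The product rule for the inner product of two sections along `f`. -/
def MetricRule (EB' : Type*) [NormedAddCommGroup EB'] [NormedSpace ℝ EB'] [ChartedSpace EB' M'] {f : M' → M} {x : M'}
    (s t : Π x, V (f x)) (Ds Dt : TangentSpace 𝓘(ℝ, EB') x →L[ℝ] V (f x)) : Prop :=
  MDifferentiableAt 𝓘(ℝ, EB') 𝓘(ℝ, ℂ) (fun y => inner ℂ (s y) (t y)) x ∧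
  ∀ X : TangentSpace 𝓘(ℝ, EB') x, mvfderiv 𝓘(ℝ, EB') (fun y => inner ℂ (s y) (t y)) x X =
    inner ℂ (Ds X) (t x) + inner ℂ (s x) (Dt X)

theorem MetricRule.symm {f : M' → M} {x : M'} {s t : Π x, V (f x)} {Ds Dt : TangentSpace 𝓘(ℝ, EB') x →L[ℝ] V (f x)}
    (h : MetricRule EB' s t Ds Dt) : MetricRule EB' t s Dt Ds := by
  have e : (fun y => inner ℂ (t y) (s y)) = (Complex.conjCLE : ℂ →L[ℝ] ℂ) ∘ fun y => inner ℂ (s y) (t y) := by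
    funext y; exact (inner_conj_symm _ _).symm
  have hd : MDifferentiableAt 𝓘(ℝ, ℂ) 𝓘(ℝ, ℂ) (Complex.conjCLE : ℂ →L[ℝ] ℂ) (inner ℂ (s x) (t x)) :=
    ContinuousLinearMap.mdifferentiableAt _
  refine ⟨e ▸ hd.comp x h.1, fun X => ?_⟩
  have h2 := mfderiv_comp x hd h.1
  have h3 : mvfderiv 𝓘(ℝ, EB') (fun y => inner ℂ (t y) (s y)) x X =
     (Complex.conjCLE : ℂ →L[ℝ] ℂ) (mvfderiv 𝓘(ℝ, EB') (fun y => inner ℂ (s y) (t y)) x X) := by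
    rw [e]
    refine (congrArg (fun L : EB' →L[ℝ] ℂ => L X) h2).trans ?_
    rw [ContinuousLinearMap.mfderiv_eq]
    rfl
  rw [h3, h.2 X]
  simp [add_comm]

theorem MetricRule.left (cov : CovariantDerivative 𝓘(ℝ, EB) W V) {f : M' → M} {x : M'}
    (hf : MDifferentiableAt 𝓘(ℝ, EB') 𝓘(ℝ, EB) f x) {t : Π x, V (f x)} {Dt : TangentSpace 𝓘(ℝ, EB') x →L[ℝ] V (f x)}
    (h : ∀ σ : Π x, V x, MDifferentiableAt 𝓘(ℝ, EB) (𝓘(ℝ, EB).prod 𝓘(ℝ, W)) (fun y => TotalSpace.mk' W (E := V) y (σ y)) (f x) →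
      MetricRule EB' (fun y => σ (f y)) t (alongCov f cov (fun y => σ (f y)) x) Dt)
    {s : Π x, V (f x)} (hs : MDC W V EB' f s x) :
    MetricRule EB' s t (alongCov f cov s x) Dt := by
  have hfc := hf.continuousAt
  refine MDC.induction (P := fun s => MetricRule EB' s t (alongCov f cov s x) Dt) hf ?_ ?_ ?_ ?_ s hs
  · intro s s' h _ hs
    have h1 : (fun y => inner ℂ (s y) (t y)) =ᶠ[𝓝 x] fun y => inner ℂ (s' y) (t y) :=
      h.mono fun y hy => by simp only [hy]
    refine ⟨hs.1.congr_of_eventuallyEq h1.symm, fun X => ?_⟩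
    rw [← mvfderiv_congr h1, hs.2 X, alongCov_congr cov h, h.self_of_nhds]
  · intro s s' h1 h2 e1 e2
    have e : (fun y => inner ℂ ((s + s') y) (t y)) = (fun y => inner ℂ (s y) (t y)) + fun y => inner ℂ (s' y) (t y) := by
      funext y; exact inner_add_left _ _ _
    refine ⟨e ▸ e1.1.add e2.1, fun X => ?_⟩
    rw [e, mvfderiv_add e1.1 e2.1, alongCov_add cov hfc h1 h2, _root_.add_apply, e1.2, e2.2, _root_.add_apply, Pi.add_apply, inner_add_left, inner_add_left]
    ring
  · intro g s hg h1 e1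
    have hr : ∀ (y : M') (r : ℝ) (v w : V (f y)), inner ℂ (r • v) w = r • inner ℂ v w := fun y r v w => by
      rw [← Complex.coe_smul r v, inner_smul_left]; simp
    have e : (fun y => inner ℂ ((g • s) y) (t y)) = g • (fun y => inner ℂ (s y) (t y)) := by
      funext y; exact hr _ _ _ _
    refine ⟨e ▸ hg.smul e1.1, fun X => ?_⟩
    rw [e, mvfderiv_smul hg e1.1, alongCov_smul cov hfc hg h1, _root_.add_apply, _root_.add_apply, _root_.smul_apply, _root_.smul_apply, e1.2,
      inner_add_left, hr]
    simp only [ContinuousLinearMap.smulRight_apply, hr, Pi.smul_apply']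
    rw [smul_add]
    ring
  · exact h

theorem alongCov_metric (cov : CovariantDerivative 𝓘(ℝ, EB) W V)
    (hd : ∀ (σ τ : Π x, V x) (x : M),
      MDifferentiableAt 𝓘(ℝ, EB) (𝓘(ℝ, EB).prod 𝓘(ℝ, W)) (fun y => TotalSpace.mk' W (E := V) y (σ y)) x →
      MDifferentiableAt 𝓘(ℝ, EB) (𝓘(ℝ, EB).prod 𝓘(ℝ, W)) (fun y => TotalSpace.mk' W (E := V) y (τ y)) x →
      MDifferentiableAt 𝓘(ℝ, EB) 𝓘(ℝ, ℂ) (fun y => inner ℂ (σ y) (τ y)) x)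
    (hm : ∀ (σ τ : Π x, V x) (x : M),
      MDifferentiableAt 𝓘(ℝ, EB) (𝓘(ℝ, EB).prod 𝓘(ℝ, W)) (fun y => TotalSpace.mk' W (E := V) y (σ y)) x →
      MDifferentiableAt 𝓘(ℝ, EB) (𝓘(ℝ, EB).prod 𝓘(ℝ, W)) (fun y => TotalSpace.mk' W (E := V) y (τ y)) x →
      ∀ X : TangentSpace 𝓘(ℝ, EB) x, mvfderiv 𝓘(ℝ, EB) (fun y => inner ℂ (σ y) (τ y)) x X =
        inner ℂ (cov σ x X) (τ x) + inner ℂ (σ x) (cov τ x X))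
    {f : M' → M} {x : M'}
    (hf : MDifferentiableAt 𝓘(ℝ, EB') 𝓘(ℝ, EB) f x) {s t : Π x : M', V (f x)} (hs : MDC W V EB' f s x) (ht : MDC W V EB' f t x) :
    MetricRule EB' s t (alongCov f cov s x) (alongCov f cov t x) := by
  refine MetricRule.left cov hf (fun σ hσ => MetricRule.symm (MetricRule.left cov hf (fun τ hτ => ?_) ht)) hs
  refine ⟨(hd τ σ _ hτ hσ).comp x hf, fun X => ?_⟩
  rw [alongCov_comp cov hf hσ, alongCov_comp cov hf hτ]
  refine Eq.trans ?_ (hm τ σ _ hτ hσ (mfderiv 𝓘(ℝ, EB') 𝓘(ℝ, EB) f x X))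
  exact congrArg (fun L : EB' →L[ℝ] ℂ => L X) (mfderiv_comp x (hd τ σ _ hτ hσ) hf)

theorem inner_sum_frm (b y : M) (hy : y ∈ (trivializationAt W V b).baseSet) (v w : V y) :
    inner ℂ v w = ∑ i, ∑ j, (cf i (trivializationAt W V b ⟨y, v⟩).2 * cf j (trivializationAt W V b ⟨y, w⟩).2) •
      inner ℂ (frm W V b i y) (frm W V b j y) := by
  conv_lhs => rw [eq_sum_frm hy v, eq_sum_frm hy w]
  rw [sum_inner]
  refine Finset.sum_congr rfl fun i _ => ?_
  rw [inner_sum]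
  refine Finset.sum_congr rfl fun j _ => ?_
  rw [← Complex.coe_smul, ← Complex.coe_smul, inner_smul_left, inner_smul_right]
  simp [mul_assoc]

theorem mdiff_inner (hi : ∀ u : Set M, IsOpen u → ∀ σ τ : Π x, V x,
      ContMDiffOn 𝓘(ℝ, EB) (𝓘(ℝ, EB).prod 𝓘(ℝ, W)) ∞ (fun y => TotalSpace.mk' W (E := V) y (σ y)) u →
      ContMDiffOn 𝓘(ℝ, EB) (𝓘(ℝ, EB).prod 𝓘(ℝ, W)) ∞ (fun y => TotalSpace.mk' W (E := V) y (τ y)) u →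
      ContMDiffOn 𝓘(ℝ, EB) 𝓘(ℝ, ℂ) ∞ (fun y => inner ℂ (σ y) (τ y)) u)
    [ContMDiffVectorBundle ∞ W V 𝓘(ℝ, EB)] (σ τ : Π x, V x) (x : M)
    (hσ : MDifferentiableAt 𝓘(ℝ, EB) (𝓘(ℝ, EB).prod 𝓘(ℝ, W)) (fun y => TotalSpace.mk' W (E := V) y (σ y)) x)
    (hτ : MDifferentiableAt 𝓘(ℝ, EB) (𝓘(ℝ, EB).prod 𝓘(ℝ, W)) (fun y => TotalSpace.mk' W (E := V) y (τ y)) x) :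
    MDifferentiableAt 𝓘(ℝ, EB) 𝓘(ℝ, ℂ) (fun y => inner ℂ (σ y) (τ y)) x := by
  have hb := (trivializationAt W V x).open_baseSet.mem_nhds (mem_baseSet_trivializationAt W V x)
  have hfr : ∀ i j, MDifferentiableAt 𝓘(ℝ, EB) 𝓘(ℝ, ℂ) (fun y => inner ℂ (frm W V x i y) (frm W V x j y)) x := fun i j =>
    ((hi _ (trivializationAt W V x).open_baseSet _ _
      (Trivialization.contMDiffOn_localFrame_baseSet ∞ (trivializationAt W V x) (Module.finBasis ℝ W) i)
      (Trivialization.contMDiffOn_localFrame_baseSet ∞ (trivializationAt W V x) (Module.finBasis ℝ W) j)).contMDiffAt hb).mdifferentiableAt (by simp)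
  have h1 : ∀ i, MDifferentiableAt 𝓘(ℝ, EB) 𝓘(ℝ, ℝ) (fun y => cf i (coordOf W id x σ y)) x := fun i =>
    ((cf i).mdifferentiableAt (x := coordOf W id x σ x)).comp x ((mdiff_base _ _).1 hσ)
  have h2 : ∀ i, MDifferentiableAt 𝓘(ℝ, EB) 𝓘(ℝ, ℝ) (fun y => cf i (coordOf W id x τ y)) x := fun i =>
    ((cf i).mdifferentiableAt (x := coordOf W id x τ x)).comp x ((mdiff_base _ _).1 hτ)
  have h3 : MDifferentiableAt 𝓘(ℝ, EB) 𝓘(ℝ, ℂ) (∑ i, ∑ j, fun y =>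
      (cf i (coordOf W id x σ y) * cf j (coordOf W id x τ y)) • inner ℂ (frm W V x i y) (frm W V x j y)) x := by
    refine MDifferentiableAt.sum fun i _ => ?_
    refine MDifferentiableAt.sum fun j _ => ?_
    exact ((h1 i).mul (h2 j)).smul (hfr i j)
  refine h3.congr_of_eventuallyEq ?_
  filter_upwards [hb] with y hy
  simp only [Finset.sum_apply]
  exact inner_sum_frm x y hy (σ y) (τ y)

theorem contMDiffAt_inner_along (hi : ∀ u : Set M, IsOpen u → ∀ σ τ : Π x, V x,
      ContMDiffOn 𝓘(ℝ, EB) (𝓘(ℝ, EB).prod 𝓘(ℝ, W)) ∞ (fun y => TotalSpace.mk' W (E := V) y (σ y)) u →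
      ContMDiffOn 𝓘(ℝ, EB) (𝓘(ℝ, EB).prod 𝓘(ℝ, W)) ∞ (fun y => TotalSpace.mk' W (E := V) y (τ y)) u →
      ContMDiffOn 𝓘(ℝ, EB) 𝓘(ℝ, ℂ) ∞ (fun y => inner ℂ (σ y) (τ y)) u)
    [ContMDiffVectorBundle ∞ W V 𝓘(ℝ, EB)] {f : M' → M} (hf : ContMDiff 𝓘(ℝ, EB') 𝓘(ℝ, EB) ∞ f) {x : M'} {s t : Π x : M', V (f x)}
    (hs : ContMDiffAt 𝓘(ℝ, EB') 𝓘(ℝ, W) ∞ (coordOf W f (f x) s) x)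
    (ht : ContMDiffAt 𝓘(ℝ, EB') 𝓘(ℝ, W) ∞ (coordOf W f (f x) t) x) :
    ContMDiffAt 𝓘(ℝ, EB') 𝓘(ℝ, ℂ) ∞ (fun y => inner ℂ (s y) (t y)) x := by
  have hb := (trivializationAt W V (f x)).open_baseSet.mem_nhds (mem_baseSet_trivializationAt W V (f x))
  have hfr : ∀ i j, ContMDiffAt 𝓘(ℝ, EB) 𝓘(ℝ, ℂ) ∞ (fun y => inner ℂ (frm W V (f x) i y) (frm W V (f x) j y)) (f x) := fun i j =>
    ((hi _ (trivializationAt W V (f x)).open_baseSet _ _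
      (Trivialization.contMDiffOn_localFrame_baseSet ∞ (trivializationAt W V (f x)) (Module.finBasis ℝ W) i)
      (Trivialization.contMDiffOn_localFrame_baseSet ∞ (trivializationAt W V (f x)) (Module.finBasis ℝ W) j)).contMDiffAt hb)
  have h1 : ∀ i, ContMDiffAt 𝓘(ℝ, EB') 𝓘(ℝ, ℝ) ∞ (fun y => cf i (coordOf W f (f x) s y)) x := fun i =>
    (cf i).contMDiff.contMDiffAt.comp x hs
  have h2 : ∀ i, ContMDiffAt 𝓘(ℝ, EB') 𝓘(ℝ, ℝ) ∞ (fun y => cf i (coordOf W f (f x) t y)) x := fun i =>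
    (cf i).contMDiff.contMDiffAt.comp x ht
  have h3 : ContMDiffAt 𝓘(ℝ, EB') 𝓘(ℝ, ℂ) ∞ (fun y => ∑ i, ∑ j, (cf i (coordOf W f (f x) s y) * cf j (coordOf W f (f x) t y)) •
      inner ℂ (frm W V (f x) i (f y)) (frm W V (f x) j (f y))) x := by
    refine ContMDiffAt.sum fun i _ => ContMDiffAt.sum fun j _ => ?_
    exact ((h1 i).mul (h2 j)).smul ((hfr i j).comp x (hf x))
  refine h3.congr_of_eventuallyEq ?_
  filter_upwards [baseSet_ev (W := W) (V := V) x hf.continuous.continuousAt] with y hy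
  exact inner_sum_frm _ _ hy (s y) (t y)
end complex

end

end Along

/-- A Hermitian bundle over a manifold `M`: a smooth complex vector bundle of finite rank with a
smooth positive-definite Hermitian inner product on its fibres and a smooth connection that is
complex linear and for which the inner product is parallel. -/
structure HermitianBundle (EB M W : Type*) [NormedAddCommGroup EB] [NormedSpace ℝ EB]
    [TopologicalSpace M] [ChartedSpace EB M] [IsManifold 𝓘(ℝ, EB) ∞ M]
    [NormedAddCommGroup W] [NormedSpace ℂ W] [FiniteDimensional ℂ W] where
  /-- the fibres -/
  Fiber : M → Type u
  [normed : ∀ x, NormedAddCommGroup (Fiber x)]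
  [inner : ∀ x, InnerProductSpace ℂ (Fiber x)]
  [top : TopologicalSpace (TotalSpace W Fiber)]
  [fiberBundle : FiberBundle W Fiber]
  [vectorBundle : VectorBundle ℂ W Fiber]
  [realVectorBundle : VectorBundle ℝ W Fiber]
  [smooth : ContMDiffVectorBundle ∞ W Fiber 𝓘(ℝ, EB)]
  inner_smooth : ∀ U : Set M, IsOpen U → ∀ σ τ : Π x, Fiber x,
    ContMDiffOn 𝓘(ℝ, EB) (𝓘(ℝ, EB).prod 𝓘(ℝ, W)) ∞ (fun x => TotalSpace.mk' W x (σ x)) U →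
    ContMDiffOn 𝓘(ℝ, EB) (𝓘(ℝ, EB).prod 𝓘(ℝ, W)) ∞ (fun x => TotalSpace.mk' W x (τ x)) U →
    ContMDiffOn 𝓘(ℝ, EB) 𝓘(ℝ, ℂ) ∞ (fun x => Inner.inner ℂ (σ x) (τ x)) U
  /-- the connection; `conn σ x X` is `∇_X σ` at `x` -/
  conn : CovariantDerivative 𝓘(ℝ, EB) W Fiber
  conn_smooth : ∀ U : Set M, IsOpen U → ContMDiffCovariantDerivativeOn W ∞ conn U
  conn_complex : ∀ (c : ℂ) (σ : Π x, Fiber x) (x : M),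
    MDifferentiableAt 𝓘(ℝ, EB) (𝓘(ℝ, EB).prod 𝓘(ℝ, W)) (fun y => TotalSpace.mk' W y (σ y)) x →
    conn (c • σ) x = c • conn σ x
  conn_metric : ∀ (σ τ : Π x, Fiber x) (x : M),
    MDifferentiableAt 𝓘(ℝ, EB) (𝓘(ℝ, EB).prod 𝓘(ℝ, W)) (fun y => TotalSpace.mk' W y (σ y)) x →
    MDifferentiableAt 𝓘(ℝ, EB) (𝓘(ℝ, EB).prod 𝓘(ℝ, W)) (fun y => TotalSpace.mk' W y (τ y)) x →
    ∀ X : TangentSpace 𝓘(ℝ, EB) x,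
      mvfderiv 𝓘(ℝ, EB) (fun y => Inner.inner ℂ (σ y) (τ y)) x X =
        Inner.inner ℂ (conn σ x X) (τ x) + Inner.inner ℂ (σ x) (conn τ x X)

namespace HermitianBundle
attribute [instance] normed inner top fiberBundle vectorBundle realVectorBundle smooth

section lift
variable {EB : Type*} [NormedAddCommGroup EB] [NormedSpace ℝ EB]
  {M : Type*} [TopologicalSpace M] [ChartedSpace EB M] [IsManifold 𝓘(ℝ, EB) ∞ M]
  {EB' : Type*} [NormedAddCommGroup EB'] [NormedSpace ℝ EB']
  {M' : Type*} [TopologicalSpace M'] [ChartedSpace EB' M'] [IsManifold 𝓘(ℝ, EB') ∞ M']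
  {W : Type*} [NormedAddCommGroup W] [NormedSpace ℂ W] [FiniteDimensional ℂ W]

theorem cmdiff_pb {V : M → Type*} [TopologicalSpace (TotalSpace W V)]
    [∀ x, NormedAddCommGroup (V x)] [∀ x, NormedSpace ℝ (V x)]
    [FiberBundle W V] [VectorBundle ℝ W V] [ContMDiffVectorBundle ∞ W V 𝓘(ℝ, EB)]
   (f : C^∞⟮𝓘(ℝ, EB'), M'; 𝓘(ℝ, EB), M⟯) (s : Π x : M', (f *ᵖ V) x) (x : M') :
   ContMDiffAt 𝓘(ℝ, EB') (𝓘(ℝ, EB').prod 𝓘(ℝ, W)) ∞ (fun y => TotalSpace.mk' W (E := f *ᵖ V) y (s y)) x ↔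
   ContMDiffAt 𝓘(ℝ, EB') (𝓘(ℝ, W)) ∞ (Along.coordOf W f (f x) s) x := by
  rw [contMDiffAt_section]
  rfl

theorem pullback_smooth {V : M → Type*} [TopologicalSpace (TotalSpace W V)]
    [∀ x, NormedAddCommGroup (V x)] [∀ x, NormedSpace ℝ (V x)]
    [FiberBundle W V] [VectorBundle ℝ W V] [ContMDiffVectorBundle ∞ W V 𝓘(ℝ, EB)]
    (f : C^∞⟮𝓘(ℝ, EB'), M'; 𝓘(ℝ, EB), M⟯) (cov : CovariantDerivative 𝓘(ℝ, EB) W V)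
    (hc : ∀ u : Set M, IsOpen u → ContMDiffCovariantDerivativeOn W ∞ cov u) (U : Set M') (hU : IsOpen U) :
    ContMDiffCovariantDerivativeOn W ∞ (Along.pullbackConn f cov) U := by
  constructor
  intro s hs x hx
  have h1 : ContMDiffAt 𝓘(ℝ, EB') (𝓘(ℝ, EB').prod 𝓘(ℝ, W)) ∞ (fun y => TotalSpace.mk' W (E := f *ᵖ V) y (s y)) x :=
    ContMDiffOn.contMDiffAt hs (hU.mem_nhds hx)
  have h2 := Along.alongCov_contMDiffAt cov hc f.contMDiff ((cmdiff_pb f s x).1 h1)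
  refine ContMDiffAt.contMDiffWithinAt ?_
  rw [contMDiffAt_hom_bundle]
  exact ⟨contMDiffAt_id, h2⟩

/-- The pull-back of a Hermitian bundle along a smooth map `f`: its fibre at `x` is the fibre at
`f x`, with the same inner product, and its connection is the pull-back connection. -/
noncomputable def lift (f : C^∞⟮𝓘(ℝ, EB'), M'; 𝓘(ℝ, EB), M⟯) (F : HermitianBundle.{u} EB M W) : HermitianBundle.{u} EB' M' W :=
  letI i1 : ∀ x, NormedAddCommGroup ((f *ᵖ F.Fiber) x) := fun x => F.normed (f x)
  letI i2 : ∀ x, InnerProductSpace ℂ ((f *ᵖ F.Fiber) x) := fun x => F.inner (f x)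
  { Fiber := f *ᵖ F.Fiber
    normed := i1
    inner := i2
    top := Pullback.TotalSpace.topologicalSpace W F.Fiber f
    fiberBundle := FiberBundle.pullback (F := W) (E := F.Fiber) f
    vectorBundle := by exact VectorBundle.pullback (F := W) (E := F.Fiber) ℂ f
    realVectorBundle := by exact VectorBundle.pullback (F := W) (E := F.Fiber) ℝ f
    smooth := by exact ContMDiffVectorBundle.pullback (IB := 𝓘(ℝ, EB)) W F.Fiber 𝓘(ℝ, EB') f
    inner_smooth := by
      intro U hU s t hs ht x hx
      have h1 := (cmdiff_pb (V := F.Fiber) f s x).1 (by exact hs.contMDiffAt (hU.mem_nhds hx))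
      have h2 := (cmdiff_pb (V := F.Fiber) f t x).1 (by exact ht.contMDiffAt (hU.mem_nhds hx))
      exact (Along.contMDiffAt_inner_along F.inner_smooth f.contMDiff h1 h2).contMDiffWithinAt
    conn := by exact Along.pullbackConn f F.conn
    conn_smooth := by exact fun U hU => pullback_smooth f F.conn F.conn_smooth U hU
    conn_complex := by
      intro c s x hs
      exact Along.alongCov_csmul F.conn F.conn_complex f.mdifferentiableAt c ((Along.mdiff_pb (V := F.Fiber) f s x).1 hs)
    conn_metric := by
      intro s t x hs ht
      exact (Along.alongCov_metric F.conn (Along.mdiff_inner F.inner_smooth) F.conn_metric f.mdifferentiableAt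
        ((Along.mdiff_pb (V := F.Fiber) f s x).1 hs) ((Along.mdiff_pb (V := F.Fiber) f t x).1 ht)).2 }
end lift

section trivial
variable {EB : Type*} [NormedAddCommGroup EB] [NormedSpace ℝ EB]
  {M : Type*} [TopologicalSpace M] [ChartedSpace EB M] [IsManifold 𝓘(ℝ, EB) ∞ M]
  {W : Type u} [NormedAddCommGroup W] [InnerProductSpace ℂ W] [FiniteDimensional ℂ W]

theorem mdiff_triv (s : M → W) (x : M) :
   MDifferentiableAt 𝓘(ℝ, EB) (𝓘(ℝ, EB).prod 𝓘(ℝ, W)) (fun y => TotalSpace.mk' W (E := Bundle.Trivial M W) y (s y)) x ↔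
   MDifferentiableAt 𝓘(ℝ, EB) (𝓘(ℝ, W)) s x := by
  rw [mdifferentiableAt_section]
  rfl

theorem cmdiff_triv (s : M → W) (x : M) :
   ContMDiffAt 𝓘(ℝ, EB) (𝓘(ℝ, EB).prod 𝓘(ℝ, W)) ∞ (fun y => TotalSpace.mk' W (E := Bundle.Trivial M W) y (s y)) x ↔
   ContMDiffAt 𝓘(ℝ, EB) (𝓘(ℝ, W)) ∞ s x := by
  rw [contMDiffAt_section]
  rfl

/-- The trivial connection on a product bundle. -/
noncomputable def trivialConn : CovariantDerivative 𝓘(ℝ, EB) W (Bundle.Trivial M W) where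
  toFun s x := mvfderiv 𝓘(ℝ, EB) (fun y => (s y : W)) x
  isCovariantDerivativeOnUniv := by
    constructor
    · intro s t x hs ht _
      exact mvfderiv_add ((mdiff_triv s x).1 hs) ((mdiff_triv t x).1 ht)
    · intro s g x hs hg _
      exact mvfderiv_smul hg ((mdiff_triv s x).1 hs)

theorem trivialConn_smooth (U : Set M) (hU : IsOpen U) :
    ContMDiffCovariantDerivativeOn (E := EB) W ∞ (trivialConn (EB := EB) (M := M) (W := W)) U := by
  constructor
  intro s hs x hx
  have h1 := (cmdiff_triv (EB := EB) s x).1 (hs.contMDiffAt (hU.mem_nhds hx))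
  have h2 := h1.mfderiv_const (m := ∞) (by simp)
  refine ContMDiffAt.contMDiffWithinAt ?_
  rw [contMDiffAt_hom_bundle]
  refine ⟨contMDiffAt_id, h2.congr_of_eventuallyEq ?_⟩
  filter_upwards with y
  ext v
  have h := TangentBundle.continuousLinearMapAt_model_space (𝕜 := ℝ) (F := W) (s x) (s y)
  have h3 := congrArg (fun L : W →L[ℝ] W => L (mvfderiv 𝓘(ℝ, EB) (fun y => (s y : W)) y
      ((trivializationAt EB (TangentSpace 𝓘(ℝ, EB) : M → Type _) x).symmL ℝ y v))) h
  refine Eq.trans ?_ h3.symm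
  simp only [ContinuousLinearMap.inCoordinates, ContinuousLinearMap.comp_apply]
  rw [Trivialization.continuousLinearMapAt_apply, Trivialization.linearMapAt_apply, if_pos (show y ∈ (trivializationAt W (Bundle.Trivial M W) x).baseSet from Set.mem_univ y)]
  rfl

variable (EB M W) in
/-- The trivial Hermitian bundle `M × W`. -/
noncomputable def trivial : HermitianBundle.{u} EB M W where
  Fiber := Bundle.Trivial M W
  normed _ := inferInstanceAs (NormedAddCommGroup W)
  inner _ := inferInstanceAs (InnerProductSpace ℂ W)
  inner_smooth := by
    intro U hU s t hs ht x hx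
    have h1 := (cmdiff_triv (EB := EB) s x).1 (by exact hs.contMDiffAt (hU.mem_nhds hx))
    have h2 := (cmdiff_triv (EB := EB) t x).1 (by exact ht.contMDiffAt (hU.mem_nhds hx))
    have h3 : ContDiff ℝ ∞ (fun p : W × W => Inner.inner ℂ p.1 p.2) := by
      exact contDiff_inner
    exact (h3.contMDiff.contMDiffAt.comp x (h1.prodMk_space h2)).contMDiffWithinAt
  conn := trivialConn
  conn_smooth := trivialConn_smooth
  conn_complex := by
    intro c s x hs
    have h1 := (mdiff_triv (EB := EB) s x).1 hs
    have h2 := mfderiv_comp (I'' := 𝓘(ℝ, W)) (g := ⇑(c • ContinuousLinearMap.id ℝ W)) x (ContinuousLinearMap.mdifferentiableAt _) h1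
    rw [ContinuousLinearMap.mfderiv_eq] at h2
    exact h2
  conn_metric := by
    intro s t x hs ht X
    have h1 := (mdiff_triv (EB := EB) s x).1 hs
    have h2 := (mdiff_triv (EB := EB) t x).1 ht
    have h3 := (isBoundedBilinearMap_inner (𝕜 := ℂ) (E := W)).hasFDerivAt (s x, t x)
    have h5 : HasMFDerivAt 𝓘(ℝ, EB) 𝓘(ℝ, W × W) (fun y => ((s y : W), (t y : W))) x
        (ContinuousLinearMap.prod (mfderiv 𝓘(ℝ, EB) 𝓘(ℝ, W) s x : EB →L[ℝ] W)
          (mfderiv 𝓘(ℝ, EB) 𝓘(ℝ, W) t x : EB →L[ℝ] W) : EB →L[ℝ] W × W) :=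
      ⟨h1.hasMFDerivAt.1.prodMk h2.hasMFDerivAt.1, h1.hasMFDerivAt.2.prodMk h2.hasMFDerivAt.2⟩
    have h4 := (HasMFDerivAt.comp (g := fun p : W × W => Inner.inner ℂ p.1 p.2) (f := fun y => (s y, t y)) x h3.hasMFDerivAt
      h5).mfderiv
    refine (congrArg (fun L : EB →L[ℝ] ℂ => L X) h4).trans ?_
    exact add_comm (G := ℂ) _ _
end trivial

section transport
variable {EB : Type*} [NormedAddCommGroup EB] [NormedSpace ℝ EB]
  {M : Type*} [TopologicalSpace M] [ChartedSpace EB M] [IsManifold 𝓘(ℝ, EB) ∞ M]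
  {W : Type*} [NormedAddCommGroup W] [NormedSpace ℂ W] [FiniteDimensional ℂ W]

variable (EB) in
/-- Piecewise smooth paths: smooth on each closed interval of a finite partition of `[0, 1]`. -/
def IsPiecewiseSmooth {x y : M} (γ : Path x y) : Prop :=
  ∃ (n : ℕ) (t : ℕ → ℝ), t 0 = 0 ∧ t n = 1 ∧ ∀ i < n, t i < t (i + 1) ∧
    ContMDiffOn 𝓘(ℝ, ℝ) 𝓘(ℝ, EB) ∞ γ.extend (Set.Icc (t i) (t (i + 1)))

/-- `w` is the parallel transport of `v` along the piecewise smooth path `γ`: there is a continuous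
section `s` along `γ` from `v` to `w` whose covariant derivative along `γ` exists and vanishes
except at finitely many parameter values. -/
def IsParallelTransport (E : HermitianBundle.{u} EB M W) {x y : M} (γ : Path x y)
    (v : E.Fiber x) (w : E.Fiber y) : Prop :=
  ∃ s : Π t : ℝ, E.Fiber (γ.extend t),
    ContinuousOn (fun t => TotalSpace.mk' W (γ.extend t) (s t)) (Set.Icc 0 1) ∧
    (∃ S : Set ℝ, S.Finite ∧ ∀ t ∈ Set.Ioo (0 : ℝ) 1 \ S,
      Along.MDC W E.Fiber ℝ γ.extend s t ∧
      Along.alongCov (EB' := ℝ) γ.extend E.conn s t (1 : ℝ) = 0) ∧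
    TotalSpace.mk' W (γ.extend 0) (s 0) = TotalSpace.mk' W x v ∧
    TotalSpace.mk' W (γ.extend 1) (s 1) = TotalSpace.mk' W y w

/-- An isomorphism of Hermitian bundles over `M`: unitary isomorphisms of the fibres which
intertwine parallel transport along all piecewise smooth paths. -/
structure Iso (E : HermitianBundle.{u} EB M W) (E' : HermitianBundle.{v} EB M W) where
  /-- the fibrewise unitary isomorphisms -/
  toFun : ∀ x, E.Fiber x ≃ₗᵢ[ℂ] E'.Fiber x
  transport_iff : ∀ {x y : M} (γ : Path x y), IsPiecewiseSmooth EB γ →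
    ∀ (v : E.Fiber x) (w : E.Fiber y),
      E.IsParallelTransport γ v w ↔ E'.IsParallelTransport γ (toFun x v) (toFun y w)

end transport

/-- A Hermitian line bundle over the unordered configurations is (a realization of) the fermionic
line bundle if its holonomy along every piecewise smooth loop `α` is the sign of the permutation
induced by `α`. -/
def IsFermionic {N d : ℕ}
    (F : HermitianBundle.{u} (Conf.ConfModel N d) (Conf.UnorderedConf N d) ℂ) : Prop :=
  ∀ (q : Conf.UnorderedConf N d) (α : Path q q), IsPiecewiseSmooth (Conf.ConfModel N d) α →
    ∀ v w : F.Fiber q, F.IsParallelTransport α v w ↔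
      w = ((Equiv.Perm.sign (Conf.loopPerm α) : ℤ) : ℂ) • v

end HermitianBundle

open Set

/-! A closed curve of ordered configurations consists of `N` curves that each return to their
starting point, so the loop it projects to induces the identity permutation (`loopPerm_map_forget`).
The pull-back of a fermionic bundle therefore has trivial holonomy along every piecewise smooth
loop. Only the holonomy matters, not the fundamental group upstairs, which is why `d = 2` is no
exception.

Trivial holonomy makes transport between two ordered configurations independent of the path
(`transport_unique`). Choosing one base point in each class of configurations joined by piecewise
smooth paths, and a unit vector over it, transport spreads this vector to a parallel frame of unit
vectors (`exists_frame`). The coordinate with respect to the frame is the isomorphism: transport in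
the trivial bundle is equality (`trivial_isParallelTransport_iff`), and transport in the pull-back
is transport along the projected path (`lift_isParallelTransport_iff`).

No differential equation is solved. The holonomy condition asserts that transports along loops
exist, and transport along an arbitrary path is the first half of the transport along the path
followed by its reverse (`exists_transport`). What remains is the calculus of transport: it respects
reversal and concatenation, can be restricted to the first half of a concatenation, commutes with
complex scalars, and preserves norms. -/

theorem eq_of_hasDerivAt_zero_off_finite {E : Type*} [NormedAddCommGroup E] [NormedSpace ℝ E]
    [CompleteSpace E] {f : ℝ → E} {S : Set ℝ} (hS : S.Finite) (hc : ContinuousOn f (Icc 0 1))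
    (hd : ∀ t ∈ Ioo (0 : ℝ) 1 \ S, HasDerivAt f 0 t) : f 0 = f 1 := by
  -- For a continuous function with integrable derivative the fundamental theorem of calculus
  -- tolerates a countable exceptional set.
  have h := MeasureTheory.integral_eq_of_hasDerivAt_off_countable_of_le f (fun _ => 0) zero_le_one
    hS.countable hc hd intervalIntegrable_const
  rw [intervalIntegral.integral_zero] at h
  exact (sub_eq_zero.1 h.symm).symm

namespace HermitianBundle

/-! ### Piecewise smooth paths -/

section piecewise
variable {EB : Type*} [NormedAddCommGroup EB] [NormedSpace ℝ EB]
  {M : Type*} [TopologicalSpace M] [ChartedSpace EB M] [IsManifold 𝓘(ℝ, EB) ∞ M]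
  {EB' : Type*} [NormedAddCommGroup EB'] [NormedSpace ℝ EB']
  {M' : Type*} [TopologicalSpace M'] [ChartedSpace EB' M'] [IsManifold 𝓘(ℝ, EB') ∞ M']

/-- `IsParallelTransport` asks only the fibre coordinate to be differentiable, while the covariant
derivative also contains `mfderiv` of the path, which is zero by default at a point of
non-differentiability. Chain rules are thus available only off the finitely many break points. -/
theorem IsPiecewiseSmooth.mdifferentiableAt_off_finite {x y : M} {γ : Path x y}
    (h : IsPiecewiseSmooth EB γ) :
    ∃ S : Set ℝ, S.Finite ∧ ∀ t ∈ Ioo (0 : ℝ) 1 \ S, MDifferentiableAt 𝓘(ℝ, ℝ) 𝓘(ℝ, EB) γ.extend t := by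
  obtain ⟨n, t, h0, h1, h⟩ := h
  refine ⟨t '' Iic n, (finite_Iic n).image t, fun s ⟨hs, hS⟩ => ?_⟩
  -- A parameter that is not a break point lies in the interior of one of the partition intervals,
  -- where smoothness on the closed interval gives differentiability.
  have key : ∀ k ≤ n, s < t k → ∃ i < n, t i < s ∧ s < t (i + 1) := by
    intro k
    induction k with
    | zero => exact fun _ hk => absurd (h0 ▸ hk) hs.1.not_gt
    | succ k ih =>
      intro hk hsk
      rcases lt_trichotomy s (t k) with h' | h' | h'
      · exact ih (by omega) h'
      · exact absurd ⟨k, by simp; omega, h'.symm⟩ hS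
      · exact ⟨k, by omega, h', hsk⟩
  obtain ⟨i, hi, hi1, hi2⟩ := key n le_rfl (h1 ▸ hs.2)
  exact ((h i hi).2.contMDiffAt (Icc_mem_nhds hi1 hi2)).mdifferentiableAt (by simp)

theorem IsPiecewiseSmooth.refl (x : M) : IsPiecewiseSmooth EB (Path.refl x) := by
  refine ⟨1, fun i => i, by simp, by simp, fun i _ => ⟨by simp, ?_⟩⟩
  rw [Path.refl_extend]
  exact contMDiffOn_const

theorem IsPiecewiseSmooth.symm {x y : M} {γ : Path x y} (h : IsPiecewiseSmooth EB γ) :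
    IsPiecewiseSmooth EB γ.symm := by
  obtain ⟨n, t, h0, h1, h⟩ := h
  refine ⟨n, fun i => 1 - t (n - i), by simp [h1], by simp [h0], fun i hi => ?_⟩
  obtain ⟨hlt, hs⟩ := h (n - (i + 1)) (by omega)
  rw [show n - (i + 1) + 1 = n - i by omega] at hlt hs
  refine ⟨by linarith, ?_⟩
  have he : (γ.symm.extend : ℝ → M) = γ.extend ∘ fun s => 1 - s :=
    funext fun s => γ.extend_symm_apply s
  rw [he]
  refine hs.comp (t := Icc _ _) ?_ fun s hs => ⟨by linarith [hs.2], by linarith [hs.1]⟩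
  exact (contDiff_const.sub contDiff_id).contMDiff.contMDiffOn

theorem IsPiecewiseSmooth.trans {x y z : M} {γ : Path x y} {γ' : Path y z}
    (h : IsPiecewiseSmooth EB γ) (h' : IsPiecewiseSmooth EB γ') :
    IsPiecewiseSmooth EB (γ.trans γ') := by
  obtain ⟨n, t, h0, h1, h⟩ := h
  obtain ⟨n', t', h0', h1', h'⟩ := h'
  -- The two bounds decide which of the two formulas for the concatenated path applies on each
  -- rescaled interval.
  have hm : ∀ k ≤ n, t k ≤ 1 := by
    intro k hk
    obtain ⟨m, rfl⟩ := Nat.exists_eq_add_of_le hk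
    clear hk
    rw [← h1]
    have : ∀ j ≤ m, t k ≤ t (k + j) := by
      intro j
      induction j with
      | zero => simp
      | succ j ih => exact fun hj => (ih (by omega)).trans (h (k + j) (by omega)).1.le
    exact this m le_rfl
  have hm' : ∀ k ≤ n', 0 ≤ t' k := by
    intro k
    induction k with
    | zero => simp [h0']
    | succ k ih => exact fun hk => (ih (by omega)).trans (h' k (by omega)).1.le
  -- The two partitions are squeezed into the two halves of `[0, 1]`. The index `n` falls into the
  -- second branch and gives `(1 + 0) / 2`, the midpoint, which is also `t n / 2`.
  refine ⟨n + n', fun i => if i < n then t i / 2 else (1 + t' (i - n)) / 2, ?_, ?_, fun i hi => ?_⟩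
  · rcases Nat.eq_zero_or_pos n with rfl | hn
    -- An empty partition would force `0 = 1`; hence index `0` is in the first branch.
    · exact absurd (h0.symm.trans h1) zero_ne_one
    · simp [hn, h0]
  · simp [h1']
  · by_cases hin : i < n
    · obtain ⟨hlt, hs⟩ := h i hin
      have e1 : (if i < n then t i / 2 else (1 + t' (i - n)) / 2) = t i / 2 := if_pos hin
      have e2 : (if i + 1 < n then t (i + 1) / 2 else (1 + t' (i + 1 - n)) / 2) = t (i + 1) / 2 := by
        split_ifs with h2
        · rfl
        · rw [show i + 1 = n by omega, h1, Nat.sub_self, h0', add_zero]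
      beta_reduce
      rw [e1, e2]
      refine ⟨by linarith, ?_⟩
      have : ContMDiffOn 𝓘(ℝ, ℝ) 𝓘(ℝ, EB) ∞ (γ.extend ∘ fun s : ℝ => 2 * s)
          (Icc (t i / 2) (t (i + 1) / 2)) := by
        refine hs.comp (t := Icc _ _) ?_ fun s hs => ⟨by linarith [hs.1], by linarith [hs.2]⟩
        exact (contDiff_const.mul contDiff_id).contMDiff.contMDiffOn
      refine this.congr fun s hs => ?_
      exact Path.extend_trans_of_le_half γ γ' (by linarith [hs.2, hm (i + 1) (by omega)])
    · obtain ⟨k, rfl⟩ := Nat.exists_eq_add_of_le (not_lt.1 hin)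
      obtain ⟨hlt, hs⟩ := h' k (by omega)
      beta_reduce
      rw [if_neg hin, if_neg (by omega), show n + k + 1 - n = k + 1 by omega,
        show n + k - n = k by omega]
      refine ⟨by linarith, ?_⟩
      have : ContMDiffOn 𝓘(ℝ, ℝ) 𝓘(ℝ, EB) ∞ (γ'.extend ∘ fun s : ℝ => 2 * s - 1)
          (Icc ((1 + t' k) / 2) ((1 + t' (k + 1)) / 2)) := by
        refine hs.comp (t := Icc _ _) ?_ fun s hs => ⟨by linarith [hs.1], by linarith [hs.2]⟩
        exact ((contDiff_const.mul contDiff_id).sub contDiff_const).contMDiff.contMDiffOn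
      refine this.congr fun s hs => ?_
      exact Path.extend_trans_of_half_le γ γ' (by linarith [hs.1, hm' k (by omega)])

theorem IsPiecewiseSmooth.map {x y : M'} {γ : Path x y} (h : IsPiecewiseSmooth EB' γ)
    (f : C^∞⟮𝓘(ℝ, EB'), M'; 𝓘(ℝ, EB), M⟯) :
    IsPiecewiseSmooth EB (γ.map f.contMDiff.continuous) := by
  obtain ⟨n, t, h0, h1, h⟩ := h
  exact ⟨n, t, h0, h1, fun i hi => ⟨(h i hi).1, f.contMDiff.comp_contMDiffOn (h i hi).2⟩⟩

end piecewise

/-! ### Parallel transport in the trivial bundle -/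

section trivial
variable {EB : Type*} [NormedAddCommGroup EB] [NormedSpace ℝ EB]
  {M : Type*} [TopologicalSpace M] [ChartedSpace EB M] [IsManifold 𝓘(ℝ, EB) ∞ M]
  {W : Type u} [NormedAddCommGroup W] [InnerProductSpace ℂ W] [FiniteDimensional ℂ W]

/-- The extension of a vector by the product trivialization is a constant section. This kills the
connection term of `alongCov`, whatever the derivative of the base curve is. -/
theorem trivialConn_extend (b : M) (w : W) :
    (trivialConn : CovariantDerivative 𝓘(ℝ, EB) W (Bundle.Trivial M W))
      (FiberBundle.extend W (E := Bundle.Trivial M W) (x := b) w) b = 0 := by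
  have : FiberBundle.extend W (E := Bundle.Trivial M W) (x := b) w = fun _ => w := by
    funext y
    exact Bundle.Trivial.trivialization_symm_apply M W y w
  rw [this]
  exact mvfderiv_const (I := 𝓘(ℝ, EB)) (M := M) (x := b) w

theorem trivial_alongCov {EB' M' : Type*} [NormedAddCommGroup EB'] [NormedSpace ℝ EB']
    [TopologicalSpace M'] [ChartedSpace EB' M'] (f : M' → M) (s : M' → W) (x : M') :
    Along.alongCov (V := Bundle.Trivial M W) (EB' := EB') f (trivialConn (EB := EB)) s x =
      mvfderiv 𝓘(ℝ, EB') s x := by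
  unfold Along.alongCov
  rw [trivialConn_extend (EB := EB) (f x) (s x), ContinuousLinearMap.zero_comp, add_zero]
  ext v
  -- Fibre coordinates in the product trivialization are the vectors themselves, so the general
  -- inversion formula, applied to a constant section along a constant map, removes `symmL`.
  exact Along.symmL_coordOf (V := Bundle.Trivial M W) (f := fun _ : M' => f x) x
    (fun _ => mvfderiv 𝓘(ℝ, EB') s x v)

/-- A parallel section is a continuous `W`-valued function with zero derivative off a finite set,
hence has equal end values; conversely constant sections are parallel. -/
theorem trivial_isParallelTransport_iff {x y : M} (γ : Path x y) (v w : W) :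
    (trivial EB M W).IsParallelTransport γ v w ↔ v = w := by
  constructor
  · rintro ⟨s, hc, ⟨S, hS, hs⟩, h0, h1⟩
    let s' : ℝ → W := s
    have h0' : s' 0 = v := congrArg (fun p : TotalSpace W (Bundle.Trivial M W) => (p.2 : W)) h0
    have h1' : s' 1 = w := congrArg (fun p : TotalSpace W (Bundle.Trivial M W) => (p.2 : W)) h1
    rw [← h0', ← h1']
    refine eq_of_hasDerivAt_zero_off_finite hS ?_ fun t ht => ?_
    · exact (continuous_snd.comp (Bundle.Trivial.homeomorphProd M W).continuous).comp_continuousOn hc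
    · obtain ⟨hd, hz⟩ := hs t ht
      have hd' : DifferentiableAt ℝ s' t := mdifferentiableAt_iff_differentiableAt.1 hd
      have hz' : fderiv ℝ s' t 1 = 0 := by
        rw [← mfderiv_eq_fderiv]
        exact (congrArg (fun L : ℝ →L[ℝ] W => L 1) (trivial_alongCov (EB := EB) γ.extend s' t)).symm.trans hz
      exact hz' ▸ hd'.hasDerivAt
  · rintro rfl
    refine ⟨fun _ => v, ?_, ⟨∅, finite_empty, fun t _ => ⟨?_, ?_⟩⟩, ?_, ?_⟩
    · exact ((Bundle.Trivial.homeomorphProd M W).symm.continuous.comp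
        (γ.continuous_extend.prodMk continuous_const)).continuousOn
    · exact mdifferentiableAt_const
    · refine (congrArg (fun L : ℝ →L[ℝ] W => L 1) (trivial_alongCov (EB := EB) γ.extend
        (fun _ => v) t)).trans ?_
      rw [mvfderiv_const]
      rfl
    · exact congrArg (fun z => TotalSpace.mk' W (E := Bundle.Trivial M W) z v) γ.extend_zero
    · exact congrArg (fun z => TotalSpace.mk' W (E := Bundle.Trivial M W) z v) γ.extend_one

end trivial

/-! ### Parallel transport in a pull-back bundle -/

section lift
variable {EB : Type*} [NormedAddCommGroup EB] [NormedSpace ℝ EB]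
  {M : Type*} [TopologicalSpace M] [ChartedSpace EB M] [IsManifold 𝓘(ℝ, EB) ∞ M]
  {EB' : Type*} [NormedAddCommGroup EB'] [NormedSpace ℝ EB']
  {M' : Type*} [TopologicalSpace M'] [ChartedSpace EB' M'] [IsManifold 𝓘(ℝ, EB') ∞ M']
  {W : Type*} [NormedAddCommGroup W] [NormedSpace ℂ W] [FiniteDimensional ℂ W]

theorem pullback_symm {V : M → Type*} [TopologicalSpace (TotalSpace W V)]
    [∀ x, AddCommMonoid (V x)] [∀ x, TopologicalSpace (V x)] [FiberBundle W V]
    (f : C^∞⟮𝓘(ℝ, EB'), M'; 𝓘(ℝ, EB), M⟯) (e : Trivialization W (π W V)) {y : M'}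
    (hy : f y ∈ e.baseSet) (w : W) : (e.pullback f).symm y w = e.symm (f y) w := by
  have h := (e.pullback f).symm_apply_apply_mk (b := y) hy (e.symm (f y) w)
  have h' : ((e.pullback f) ⟨y, e.symm (f y) w⟩).2 = w :=
    congrArg Prod.snd (e.apply_mk_symm hy w)
  rwa [h'] at h

/-- Near `b` the extension upstairs is the extension downstairs composed with `f`, because the
trivialization upstairs is the pulled-back one. On sections of the form `σ ∘ f` the pull-back
connection is `∇σ ∘ df`. -/
theorem lift_conn_extend (f : C^∞⟮𝓘(ℝ, EB'), M'; 𝓘(ℝ, EB), M⟯) (E : HermitianBundle.{u} EB M W)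
    (b : M') (v : E.Fiber (f b)) :
    (E.lift f).conn (FiberBundle.extend W (E := (E.lift f).Fiber) v) b =
      (E.conn (FiberBundle.extend W v) (f b)).comp (mfderiv 𝓘(ℝ, EB') 𝓘(ℝ, EB) f b) := by
  have h : (E.lift f).conn (FiberBundle.extend W (E := (E.lift f).Fiber) v) b =
    Along.alongCov f E.conn (fun y => FiberBundle.extend W v (f y)) b := by
    refine Along.alongCov_congr E.conn ?_
    filter_upwards [Along.baseSet_ev (W := W) (V := E.Fiber) (f := f) b f.contMDiff.continuous.continuousAt] with y hy
    exact pullback_symm f (trivializationAt W E.Fiber (f b)) hy _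
  rw [h]
  exact Along.alongCov_comp E.conn (f.contMDiff.mdifferentiableAt (by simp)) (FiberBundle.mdifferentiableAt_extend 𝓘(ℝ, EB) W v)

/-- The fibre coordinates of `s` are the same in both bundles; the connection terms agree by the
chain rule for `f ∘ g`, which needs `g` to be differentiable at `t`. -/
theorem lift_alongCov (f : C^∞⟮𝓘(ℝ, EB'), M'; 𝓘(ℝ, EB), M⟯) (E : HermitianBundle.{u} EB M W)
    {g : ℝ → M'} {t : ℝ} (hg : MDifferentiableAt 𝓘(ℝ, ℝ) 𝓘(ℝ, EB') g t)
    (s : Π t, E.Fiber (f (g t))) :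
    Along.alongCov (EB' := ℝ) (V := (E.lift f).Fiber) g (E.lift f).conn s t =
      Along.alongCov (EB' := ℝ) (fun t => f (g t)) E.conn s t := by
  unfold Along.alongCov
  have h1 := lift_conn_extend f E (g t) (s t)
  have h2 := mfderiv_comp t (f.contMDiff.mdifferentiableAt (x := g t) (by simp)) hg
  refine congrArg₂ (· + ·) ?_ ?_
  · ext
    exact (Trivialization.symmL_apply _ (mem_baseSet_trivializationAt W (E.lift f).Fiber (g t)) _).trans <|
      (pullback_symm f (trivializationAt W E.Fiber (f (g t)))
        (mem_baseSet_trivializationAt W E.Fiber (f (g t))) _).trans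
      (Trivialization.symmL_apply _ (mem_baseSet_trivializationAt W E.Fiber (f (g t))) _).symm
  · rw [h1]
    exact congrArg (fun L => (E.conn (FiberBundle.extend W (s t)) (f (g t))).comp L) h2.symm

/-- Since `f` may identify distinct points, an equality downstairs says nothing about base points
upstairs; `x = y` has to be supplied. -/
theorem lift_mk_eq_iff {V : M → Type*} (f : C^∞⟮𝓘(ℝ, EB'), M'; 𝓘(ℝ, EB), M⟯) {x y : M'}
    (h : x = y) (v : V (f x)) (w : V (f y)) :
    TotalSpace.mk' W (E := f *ᵖ V) x v = TotalSpace.mk' W (E := f *ᵖ V) y w ↔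
      TotalSpace.mk' W (f x) v = TotalSpace.mk' W (f y) w := by
  subst h
  exact (TotalSpace.mk_inj (F := W) (E := f *ᵖ V)).trans
    (TotalSpace.mk_inj (F := W) (E := V)).symm

theorem lift_isParallelTransport_iff (f : C^∞⟮𝓘(ℝ, EB'), M'; 𝓘(ℝ, EB), M⟯)
    (E : HermitianBundle.{u} EB M W) {x y : M'} {γ : Path x y} (hγ : IsPiecewiseSmooth EB' γ)
    (v : E.Fiber (f x)) (w : E.Fiber (f y)) :
    (E.lift f).IsParallelTransport γ v w ↔
      E.IsParallelTransport (γ.map f.contMDiff.continuous) v w := by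
  obtain ⟨D, hD, hd⟩ := hγ.mdifferentiableAt_off_finite
  -- The fibres of the pull-back along `γ` are by definition those of `E` along `f ∘ γ`, so one and
  -- the same section serves on both sides.
  refine exists_congr fun s => and_congr ?_ (and_congr ?_ (and_congr ?_ ?_))
  -- The topology upstairs is induced from the product of `M'` and the total space of `E`, and the
  -- base component is the continuous path.
  · have h := (_root_.inducing_pullbackTotalSpaceEmbedding W E.Fiber f).continuousOn_iff
      (f := fun t => TotalSpace.mk' W (E := f *ᵖ E.Fiber) (γ.extend t) (s t)) (s := Icc 0 1)
    refine h.trans ⟨fun h => continuous_snd.comp_continuousOn h,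
      fun h => γ.continuous_extend.continuousOn.prodMk h⟩
  · constructor
    · rintro ⟨S, hS, hs⟩
      refine ⟨S ∪ D, hS.union hD, fun t ht => ?_⟩
      obtain ⟨h1, h2⟩ := hs t ⟨ht.1, fun h => ht.2 (Or.inl h)⟩
      have h3 := hd t ⟨ht.1, fun h => ht.2 (Or.inr h)⟩
      exact ⟨h1, (congrArg (fun L : ℝ →L[ℝ] E.Fiber (f (γ.extend t)) => L 1)
        (lift_alongCov f E h3 s)).symm.trans h2⟩
    · rintro ⟨S, hS, hs⟩
      refine ⟨S ∪ D, hS.union hD, fun t ht => ?_⟩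
      obtain ⟨h1, h2⟩ := hs t ⟨ht.1, fun h => ht.2 (Or.inl h)⟩
      have h3 := hd t ⟨ht.1, fun h => ht.2 (Or.inr h)⟩
      exact ⟨h1, (congrArg (fun L : ℝ →L[ℝ] E.Fiber (f (γ.extend t)) => L 1)
        (lift_alongCov f E h3 s)).trans h2⟩
  · exact lift_mk_eq_iff f γ.extend_zero (s 0) v
  · exact lift_mk_eq_iff f γ.extend_one (s 1) w

end lift

end HermitianBundle

namespace HermitianBundle

/-! ### Parallel transport as horizontal curves in the total space -/

section horizontal
variable {EB : Type*} [NormedAddCommGroup EB] [NormedSpace ℝ EB]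
  {M : Type*} [TopologicalSpace M] [ChartedSpace EB M] [IsManifold 𝓘(ℝ, EB) ∞ M]
  {W : Type*} [NormedAddCommGroup W] [NormedSpace ℂ W] [FiniteDimensional ℂ W]
  (E : HermitianBundle.{u} EB M W)

/-- A curve in the total space is horizontal at `t`: its projection to the base and its fibre
coordinate are differentiable there, and its covariant derivative vanishes. -/
def IsHorizontalAt (σ : ℝ → TotalSpace W E.Fiber) (t : ℝ) : Prop :=
  ∃ (p : TotalSpace W E.Fiber) (c : W) (b : ℝ →L[ℝ] EB), σ t = p ∧
    HasDerivAt (fun y => (trivializationAt W E.Fiber p.proj (σ y)).2) c t ∧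
    HasMFDerivAt 𝓘(ℝ, ℝ) 𝓘(ℝ, EB) (fun y => (σ y).proj) t b ∧
    (trivializationAt W E.Fiber p.proj).symmL ℝ p.proj c +
      E.conn (FiberBundle.extend W p.2) p.proj (b 1) = 0

variable {E}

theorem IsHorizontalAt.congr {σ τ : ℝ → TotalSpace W E.Fiber} {t : ℝ} (h : E.IsHorizontalAt σ t)
    (hστ : τ =ᶠ[𝓝 t] σ) : E.IsHorizontalAt τ t := by
  obtain ⟨p, c, b, hp, h1, h2, h3⟩ := h
  refine ⟨p, c, b, hστ.self_of_nhds.trans hp, h1.congr_of_eventuallyEq ?_,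
    h2.congr_of_eventuallyEq ?_, h3⟩
  · exact hστ.mono fun y hy => by simp only [hy]
  · exact hστ.mono fun y hy => by simp only [hy]

/-- By the chain rule `c` and `b` are both scaled by `a`, and the horizontality equation is linear
in the pair. -/
theorem IsHorizontalAt.comp {σ : ℝ → TotalSpace W E.Fiber} {φ : ℝ → ℝ} {a t : ℝ}
    (h : E.IsHorizontalAt σ (φ t)) (hφ : HasDerivAt φ a t) :
    E.IsHorizontalAt (fun y => σ (φ y)) t := by
  obtain ⟨p, c, b, hp, h1, h2, h3⟩ := h
  refine ⟨p, a • c, b.comp (ContinuousLinearMap.toSpanSingleton ℝ a), hp, h1.scomp t hφ,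
    h2.comp t hφ.hasFDerivAt.hasMFDerivAt, ?_⟩
  have e : (b.comp (ContinuousLinearMap.toSpanSingleton ℝ a)) 1 = a • b 1 := by simp [← map_smul]
  rw [e, map_smul]
  refine (congrArg (fun z : E.Fiber p.proj =>
    a • (trivializationAt W E.Fiber p.proj).symmL ℝ p.proj c + z) (map_smul (E.conn (FiberBundle.extend W p.2) p.proj) a (b 1))).trans ?_
  rw [← smul_add]
  exact (congrArg (a • ·) h3).trans (smul_zero a)

theorem isHorizontalAt_iff {g : ℝ → M} {t : ℝ} (hg : MDifferentiableAt 𝓘(ℝ, ℝ) 𝓘(ℝ, EB) g t)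
    (s : Π t, E.Fiber (g t)) :
    E.IsHorizontalAt (fun t => TotalSpace.mk' W (g t) (s t)) t ↔
      Along.MDC W E.Fiber ℝ g s t ∧ Along.alongCov (EB' := ℝ) g E.conn s t (1 : ℝ) = 0 := by
  constructor
  · rintro ⟨p, c, b, rfl, h1, h2, h3⟩
    refine ⟨h1.differentiableAt.mdifferentiableAt, Eq.trans ?_ h3⟩
    refine congrArg₂ (fun a b : E.Fiber (g t) => a + b) ?_ ?_
    · refine congrArg ((trivializationAt W E.Fiber (g t)).symmL ℝ (g t)) ?_
      exact (congrArg (fun L : ℝ →L[ℝ] W => L 1) h1.hasFDerivAt.hasMFDerivAt.mfderiv).trans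
        (one_smul ℝ c)
    · exact congrArg (fun L : ℝ →L[ℝ] EB => E.conn (FiberBundle.extend W (s t)) (g t) (L 1)) h2.mfderiv
  · rintro ⟨h1, h2⟩
    have h1' := (mdifferentiableAt_iff_differentiableAt.1 h1).hasDerivAt
    refine ⟨_, _, mfderiv 𝓘(ℝ, ℝ) 𝓘(ℝ, EB) g t, rfl, h1', hg.hasMFDerivAt, Eq.trans ?_ h2⟩
    refine congrArg₂ (fun a b : E.Fiber (g t) => a + b) ?_ rfl
    refine congrArg ((trivializationAt W E.Fiber (g t)).symmL ℝ (g t)) ?_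
    exact (congrArg (fun L : ℝ →L[ℝ] W => L 1) (mfderiv_eq_fderiv (f := Along.coordOf W g (g t) s) (x := t))).symm

/-- As `g` is a variable, the projected curve can be substituted for it, and no cast between fibres
arises. -/
theorem exists_section_of_proj_eq (g : ℝ → M) (σ : ℝ → TotalSpace W E.Fiber)
    (h : ∀ t, (σ t).proj = g t) :
    ∃ s : Π t, E.Fiber (g t), σ = fun t => TotalSpace.mk' W (g t) (s t) := by
  obtain rfl : (fun t => (σ t).proj) = g := funext h
  exact ⟨fun t => (σ t).2, rfl⟩

/-- Sections along a path are dependent functions, so reparametrizing or gluing them would require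
casts between fibres over equal points. Curves in the total space have a fixed codomain, which makes
reversal, concatenation and restriction plain compositions. -/
theorem isParallelTransport_iff {x y : M} {γ : Path x y} (hγ : IsPiecewiseSmooth EB γ)
    (v : E.Fiber x) (w : E.Fiber y) :
    E.IsParallelTransport γ v w ↔ ∃ σ : ℝ → TotalSpace W E.Fiber,
      ContinuousOn σ (Icc 0 1) ∧
      (∃ S : Set ℝ, S.Finite ∧ ∀ t ∈ Ioo (0 : ℝ) 1 \ S, E.IsHorizontalAt σ t) ∧
      (∀ t ∈ Icc (0 : ℝ) 1, (σ t).proj = γ.extend t) ∧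
      σ 0 = TotalSpace.mk' W x v ∧ σ 1 = TotalSpace.mk' W y w := by
  obtain ⟨D, hD, hd⟩ := hγ.mdifferentiableAt_off_finite
  constructor
  · rintro ⟨s, hc, ⟨S, hS, hs⟩, h0, h1⟩
    refine ⟨_, hc, ⟨S ∪ D, hS.union hD, fun t ht => ?_⟩, fun _ _ => rfl, h0, h1⟩
    exact (isHorizontalAt_iff (hd t ⟨ht.1, fun h => ht.2 (Or.inr h)⟩) s).2
      (hs t ⟨ht.1, fun h => ht.2 (Or.inl h)⟩)
  · rintro ⟨σ, hc, ⟨S, hS, hs⟩, hp, h0, h1⟩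
    -- Outside `[0, 1]` nothing is known about `σ`; clamping the parameter makes the curve lie over
    -- `γ.extend` everywhere and does not change it on `[0, 1]`.
    obtain ⟨s, hτ⟩ := exists_section_of_proj_eq γ.extend (fun t => σ (projIcc 0 1 zero_le_one t))
      fun t => by
        rw [hp _ (projIcc 0 1 zero_le_one t).2, Path.extend_extends']
        rfl
    have he : ∀ t ∈ Icc (0 : ℝ) 1, σ t = TotalSpace.mk' W (γ.extend t) (s t) := fun t ht => by
      rw [← congrFun hτ t, projIcc_of_mem zero_le_one ht]
    refine ⟨s, hc.congr fun t ht => (he t ht).symm, ⟨S ∪ D, hS.union hD, fun t ht => ?_⟩,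
      (he 0 (by simp)).symm.trans h0, (he 1 (by simp)).symm.trans h1⟩
    refine (isHorizontalAt_iff (hd t ⟨ht.1, fun h => ht.2 (Or.inr h)⟩) s).1
      ((hs t ⟨ht.1, fun h => ht.2 (Or.inl h)⟩).congr ?_)
    filter_upwards [Icc_mem_nhds ht.1.1 ht.1.2] with r hr using (he r hr).symm

theorem IsParallelTransport.symm {x y : M} {γ : Path x y} (hγ : IsPiecewiseSmooth EB γ)
    {v : E.Fiber x} {w : E.Fiber y} (h : E.IsParallelTransport γ v w) :
    E.IsParallelTransport γ.symm w v := by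
  obtain ⟨σ, hc, ⟨S, hS, hs⟩, hp, h0, h1⟩ := (isParallelTransport_iff hγ v w).1 h
  refine (isParallelTransport_iff hγ.symm w v).2 ⟨fun t => σ (1 - t), ?_,
    ⟨(fun t => 1 - t) ⁻¹' S, hS.preimage (sub_right_injective.injOn), fun t ht => ?_⟩,
    fun t ht => ?_, by simpa using h1, by simpa using h0⟩
  · exact hc.comp (by fun_prop) fun t ht => ⟨by linarith [ht.2], by linarith [ht.1]⟩
  · exact (hs (1 - t) ⟨⟨by linarith [ht.1.2], by linarith [ht.1.1]⟩, ht.2⟩).comp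
      ((hasDerivAt_id t).const_sub 1)
  · rw [hp (1 - t) ⟨by linarith [ht.2], by linarith [ht.1]⟩, Path.extend_symm_apply]

theorem IsParallelTransport.trans {x y z : M} {γ : Path x y} {γ' : Path y z}
    (hγ : IsPiecewiseSmooth EB γ) (hγ' : IsPiecewiseSmooth EB γ')
    {u : E.Fiber x} {v : E.Fiber y} {w : E.Fiber z} (h : E.IsParallelTransport γ u v)
    (h' : E.IsParallelTransport γ' v w) : E.IsParallelTransport (γ.trans γ') u w := by
  obtain ⟨σ, hc, ⟨S, hS, hs⟩, hp, h0, h1⟩ := (isParallelTransport_iff hγ u v).1 h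
  obtain ⟨σ', hc', ⟨S', hS', hs'⟩, hp', h0', h1'⟩ := (isParallelTransport_iff hγ' v w).1 h'
  let τ : ℝ → TotalSpace W E.Fiber := fun t => if t ≤ 1 / 2 then σ (2 * t) else σ' (2 * t - 1)
  have hl : ∀ t ≤ 1 / 2, τ t = σ (2 * t) := fun t ht => if_pos ht
  have hr : ∀ t, 1 / 2 ≤ t → τ t = σ' (2 * t - 1) := fun t ht => by
    rcases ht.eq_or_lt with rfl | ht
    · rw [hl _ le_rfl]
      norm_num
      rw [h1, h0']
    · exact if_neg ht.not_ge
  have i1 : Function.Injective fun t : ℝ => 2 * t := fun a b h => by simpa using h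
  have i2 : Function.Injective fun t : ℝ => 2 * t - 1 := fun a b h => by simpa using h
  refine (isParallelTransport_iff (hγ.trans hγ') u w).2 ⟨τ, ?_,
    -- The glued curve may have a corner at the midpoint, so this joins the two rescaled exceptional
    -- sets.
    ⟨{1 / 2} ∪ ((fun t => 2 * t) ⁻¹' S ∪ (fun t => 2 * t - 1) ⁻¹' S'),
      (finite_singleton _).union ((hS.preimage i1.injOn).union (hS'.preimage i2.injOn)),
      fun t ht => ?_⟩, fun t ht => ?_, ?_, ?_⟩
  · have hu : Icc (0 : ℝ) 1 = Icc 0 (1 / 2) ∪ Icc (1 / 2) 1 :=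
      (Icc_union_Icc_eq_Icc (by norm_num) (by norm_num)).symm
    rw [hu]
    refine ContinuousOn.union_of_isClosed ?_ ?_ isClosed_Icc isClosed_Icc
    · refine ContinuousOn.congr (f := fun t => σ (2 * t)) ?_ fun t ht => hl t ht.2
      exact hc.comp (by fun_prop) fun t ht => ⟨by linarith [ht.1], by linarith [ht.2]⟩
    · refine ContinuousOn.congr (f := fun t => σ' (2 * t - 1)) ?_ fun t ht => hr t ht.1
      exact hc'.comp (by fun_prop) fun t ht => ⟨by linarith [ht.1], by linarith [ht.2]⟩
  · simp only [mem_sdiff, mem_union, mem_singleton_iff, not_or, mem_preimage] at ht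
    obtain ⟨⟨ht0, ht1⟩, hne, hS, hS'⟩ := ht
    rcases lt_or_gt_of_ne hne with hlt | hgt
    · refine ((hs (2 * t) ⟨⟨by linarith, by linarith⟩, hS⟩).comp
        ((hasDerivAt_id t).const_mul 2)).congr ?_
      filter_upwards [Iio_mem_nhds hlt] with r hr using hl r (le_of_lt hr)
    · refine ((hs' (2 * t - 1) ⟨⟨by linarith, by linarith⟩, hS'⟩).comp
        (φ := fun r => 2 * r - 1) (((hasDerivAt_id t).const_mul 2).sub_const 1)).congr ?_
      filter_upwards [Ioi_mem_nhds hgt] with r hr' using hr r (le_of_lt hr')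
  · rcases le_total t (1 / 2) with h | h
    · rw [hl t h, Path.extend_trans_of_le_half _ _ h, hp _ ⟨by linarith [ht.1], by linarith⟩]
    · rw [hr t h, Path.extend_trans_of_half_le _ _ h, hp' _ ⟨by linarith, by linarith [ht.2]⟩]
  · rw [hl 0 (by norm_num), mul_zero, h0]
  · rw [hr 1 (by norm_num)]
    norm_num
    exact h1'

/-- The first half of a horizontal curve is horizontal. This is the source of existence of transport
along paths that are not closed. -/
theorem IsParallelTransport.exists_left {x y z : M} {γ : Path x y} {γ' : Path y z}
    (hγ : IsPiecewiseSmooth EB γ) (hγ' : IsPiecewiseSmooth EB γ')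
    {u : E.Fiber x} {w : E.Fiber z} (h : E.IsParallelTransport (γ.trans γ') u w) :
    ∃ v, E.IsParallelTransport γ u v := by
  obtain ⟨σ, hc, ⟨S, hS, hs⟩, hp, h0, h1⟩ := (isParallelTransport_iff (hγ.trans hγ') u w).1 h
  have hp' : ∀ t ∈ Icc (0 : ℝ) 1, (σ (t / 2)).proj = γ.extend t := fun t ht => by
    rw [hp _ ⟨by linarith [ht.1], by linarith [ht.2]⟩,
      Path.extend_trans_of_le_half _ _ (by linarith [ht.2])]
    congr 1
    ring
  have hy : (σ (1 / 2)).proj = y := (hp' 1 (by simp)).trans γ.extend_one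
  have hi : Function.Injective fun t : ℝ => t / 2 := fun a b h => by simpa using h
  obtain ⟨v, hv⟩ : ∃ v, σ (1 / 2) = TotalSpace.mk' W y v := by
    generalize σ (1 / 2) = p at hy
    subst hy
    exact ⟨p.2, rfl⟩
  refine ⟨v, (isParallelTransport_iff hγ _ _).2 ⟨fun t => σ (t / 2), ?_,
    ⟨(fun t => t / 2) ⁻¹' S, hS.preimage hi.injOn, fun t ht => ?_⟩, hp', by simpa using h0, hv⟩⟩
  · exact hc.comp (by fun_prop) fun t ht => ⟨by linarith [ht.1], by linarith [ht.2]⟩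
  · exact (hs (t / 2) ⟨⟨by linarith [ht.1.1], by linarith [ht.1.2]⟩, ht.2⟩).comp
      (φ := fun r => r / 2) ((hasDerivAt_id t).div_const 2)

/-- The connection is complex linear, so a multiple of a parallel section is parallel. -/
theorem IsParallelTransport.smul {x y : M} {γ : Path x y} (hγ : IsPiecewiseSmooth EB γ)
    {v : E.Fiber x} {w : E.Fiber y} (h : E.IsParallelTransport γ v w) (c : ℂ) :
    E.IsParallelTransport γ (c • v) (c • w) := by
  obtain ⟨D, hD, hd⟩ := hγ.mdifferentiableAt_off_finite
  obtain ⟨s, hc, ⟨S, hS, hs⟩, h0, h1⟩ := h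
  -- The end conditions are equalities in the total space over base points that agree only
  -- propositionally; general `a` and `b` can be identified by substitution.
  have hm : ∀ {a b : M}, a = b → ∀ (p : E.Fiber a) (q : E.Fiber b),
      TotalSpace.mk' W a p = TotalSpace.mk' W b q →
      TotalSpace.mk' W a (c • p) = TotalSpace.mk' W b (c • q) := by
    rintro a _ rfl p q h
    rw [TotalSpace.mk_inj.1 h]
  refine ⟨fun t => c • s t, fun t ht => ?_, ⟨S ∪ D, hS.union hD, fun t ht => ?_⟩,
    hm γ.extend_zero _ _ h0, hm γ.extend_one _ _ h1⟩
  · have h := (FiberBundle.continuousWithinAt_totalSpace W _).1 (hc t ht)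
    refine (FiberBundle.continuousWithinAt_totalSpace W _).2 ⟨h.1, ?_⟩
    refine (h.2.const_smul c).congr_of_eventuallyEq ?_ ?_
    · filter_upwards [mem_nhdsWithin_of_mem_nhds (Along.baseSet_ev (W := W) (V := E.Fiber) t
        γ.continuous_extend.continuousAt)] with r hr
      exact ((trivializationAt W E.Fiber (γ.extend t)).linear ℂ hr).map_smul c (s r)
    · exact ((trivializationAt W E.Fiber (γ.extend t)).linear ℂ
        (mem_baseSet_trivializationAt W E.Fiber _)).map_smul c (s t)
  · obtain ⟨h1, h2⟩ := hs t ⟨ht.1, fun h => ht.2 (Or.inl h)⟩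
    have h3 := hd t ⟨ht.1, fun h => ht.2 (Or.inr h)⟩
    refine ⟨h1.csmul h3.continuousAt c, ?_⟩
    have h4 := Along.alongCov_csmul E.conn E.conn_complex h3 c h1
    refine (congrArg (fun L : ℝ →L[ℝ] E.Fiber (γ.extend t) => L 1) h4).trans ?_
    exact (congrArg (c • ·) h2).trans (smul_zero c)

/-- Smoothness of the metric is given for smooth local sections only, while a parallel section is
merely continuous at its exceptional parameters. In a local frame the squared norm is a polynomial
in the fibre coordinates whose coefficients are inner products of frame sections. -/
theorem continuous_inner_self :
    Continuous fun p : TotalSpace W E.Fiber => (Inner.inner ℂ p.2 p.2 : ℂ) := by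
  refine continuous_iff_continuousAt.2 fun p => ?_
  let e := trivializationAt W E.Fiber p.proj
  have hb : p.proj ∈ e.baseSet := mem_baseSet_trivializationAt W E.Fiber p.proj
  have hfr : ∀ i j, ContinuousAt (fun q : TotalSpace W E.Fiber => (Inner.inner ℂ
      (Along.frm W E.Fiber p.proj i q.proj) (Along.frm W E.Fiber p.proj j q.proj) : ℂ)) p :=
    fun i j => ((E.inner_smooth _ e.open_baseSet _ _
      (Trivialization.contMDiffOn_localFrame_baseSet ∞ e (Module.finBasis ℝ W) i)
      (Trivialization.contMDiffOn_localFrame_baseSet ∞ e (Module.finBasis ℝ W) j)).contMDiffAt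
        (e.open_baseSet.mem_nhds hb)).continuousAt.comp
      (f := fun q : TotalSpace W E.Fiber => q.proj)
      (FiberBundle.continuous_proj W E.Fiber).continuousAt
  have he : ContinuousAt (fun q : TotalSpace W E.Fiber => (e q).2) p :=
    continuous_snd.continuousAt.comp (e.continuousAt (e.mem_source.2 hb))
  have hcf : ∀ i, ContinuousAt (fun q : TotalSpace W E.Fiber => Along.cf i (e q).2) p :=
    fun i => (Along.cf i).continuous.continuousAt.comp he
  have hsum : ContinuousAt (fun q : TotalSpace W E.Fiber => ∑ i, ∑ j,
      (Along.cf i (e q).2 * Along.cf j (e q).2) • (Inner.inner ℂ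
      (Along.frm W E.Fiber p.proj i q.proj) (Along.frm W E.Fiber p.proj j q.proj) : ℂ)) p :=
    tendsto_finsetSum _ fun i _ => tendsto_finsetSum _ fun j _ =>
      ((hcf i).mul (hcf j)).smul (hfr i j)
  refine hsum.congr ?_
  filter_upwards [(FiberBundle.continuous_proj W E.Fiber).continuousAt.eventually
    (e.open_baseSet.mem_nhds hb)] with q hq
  exact (Along.inner_sum_frm p.proj q.proj hq q.2 q.2).symm

theorem IsParallelTransport.norm_eq {x y : M} {γ : Path x y} (hγ : IsPiecewiseSmooth EB γ)
    {v : E.Fiber x} {w : E.Fiber y} (h : E.IsParallelTransport γ v w) : ‖v‖ = ‖w‖ := by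
  obtain ⟨D, hD, hd⟩ := hγ.mdifferentiableAt_off_finite
  obtain ⟨s, hc, ⟨S, hS, hs⟩, h0, h1⟩ := h
  -- As the metric is parallel, the squared norm along `s` has derivative `⟨Ds, s⟩ + ⟨s, Ds⟩ = 0`
  -- off a finite set.
  have key : (Inner.inner ℂ (s 0) (s 0) : ℂ) = Inner.inner ℂ (s 1) (s 1) := by
    refine eq_of_hasDerivAt_zero_off_finite (f := fun t => (Inner.inner ℂ (s t) (s t) : ℂ))
      (hS.union hD) (continuous_inner_self.comp_continuousOn hc) fun t ht => ?_
    obtain ⟨h1, h2⟩ := hs t ⟨ht.1, fun h => ht.2 (Or.inl h)⟩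
    have h3 := hd t ⟨ht.1, fun h => ht.2 (Or.inr h)⟩
    obtain ⟨h4, h5⟩ := Along.alongCov_metric E.conn (Along.mdiff_inner E.inner_smooth)
      E.conn_metric h3 h1 h1
    have h6 := (mdifferentiableAt_iff_differentiableAt.1 h4).hasDerivAt
    have h7 : deriv (fun t => (Inner.inner ℂ (s t) (s t) : ℂ)) t = 0 := by
      refine (congrArg (fun L : ℝ →L[ℝ] ℂ => L 1) mfderiv_eq_fderiv).symm.trans ((h5 (1 : ℝ)).trans ?_)
      rw [h2, inner_zero_left, inner_zero_right, add_zero]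
    exact h7 ▸ h6
  have hn : ∀ p q : TotalSpace W E.Fiber, p = q →
      (Inner.inner ℂ p.2 p.2 : ℂ) = Inner.inner ℂ q.2 q.2 := by
    rintro p _ rfl
    rfl
  have h : (Inner.inner ℂ v v : ℂ) = Inner.inner ℂ w w :=
    (hn _ _ h0).symm.trans (key.trans (hn _ _ h1))
  rw [inner_self_eq_norm_sq_to_K, inner_self_eq_norm_sq_to_K] at h
  have h' : ‖v‖ ^ 2 = ‖w‖ ^ 2 := by exact_mod_cast h
  exact (sq_eq_sq₀ (norm_nonneg v) (norm_nonneg w)).1 h'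

end horizontal

end HermitianBundle

/-! ### Loops of ordered configurations induce the identity permutation -/

namespace Conf

/-- `loopPerm` lifts the loop from a chosen ordering, which need not be `x` but is `τ • x` for some
`τ`. By uniqueness of lifts the lift is `τ • β`, again closed, so the initial and final enumerations
coincide. -/
theorem loopPerm_map_forget {N d : ℕ} {x : OrderedConf N d} (β : Path x x) :
    loopPerm (β.map (contMDiff_forget N d).continuous) = 1 := by
  set α := β.map (contMDiff_forget N d).continuous
  have cov := isCoveringMap_forget N d
  have hx := (forget_surjective N d (forget N d x)).choose_spec
  have hβ : ∀ (y) (h0 : α.toContinuousMap 0 = forget N d y), forget N d y = forget N d x →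
      cov.liftPath α.toContinuousMap y h0 0 = cov.liftPath α.toContinuousMap y h0 1 := by
    intro y h0 hy
    obtain ⟨τ, rfl⟩ := forget_eq_iff.1 hy
    have h : (fun t => τ • β t) = cov.liftPath α.toContinuousMap (τ • x) h0 := by
      refine (cov.eq_liftPath_iff h0).2 ⟨β.continuous.const_smul τ, funext fun t => ?_, ?_⟩
      · exact forget_eq_iff.2 ⟨τ, rfl⟩
      · exact congrArg (τ • ·) β.source
    have h0 := congrFun h 0
    have h1 := congrFun h 1
    rw [← h0, ← h1, β.source, β.target]
  -- `ordering` takes a proof about its configuration as an argument; quantifying over both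
  -- configurations lets their equality be substituted.
  have hord : ∀ (y z : OrderedConf N d) (hy : forget N d y = forget N d x)
      (hz : forget N d z = forget N d x), y = z →
      (ordering y _ hy).symm.trans (ordering z _ hz) = 1 := by
    rintro y _ hy hz rfl
    exact Equiv.symm_trans_self _
  exact hord _ _ _ _ (hβ _ _ hx)

end Conf

/-! ### The parallel unit frame over ordered configurations -/

namespace HermitianBundle

theorem finrank_fiber {EB : Type*} [NormedAddCommGroup EB] [NormedSpace ℝ EB]
    {M : Type*} [TopologicalSpace M] [ChartedSpace EB M] [IsManifold 𝓘(ℝ, EB) ∞ M]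
    {W : Type*} [NormedAddCommGroup W] [NormedSpace ℂ W] [FiniteDimensional ℂ W]
    (E : HermitianBundle.{u} EB M W) (x : M) :
    Module.finrank ℂ (E.Fiber x) = Module.finrank ℂ W :=
  ((trivializationAt W E.Fiber x).continuousLinearEquivAt ℂ x
    (mem_baseSet_trivializationAt W E.Fiber x)).toLinearEquiv.finrank_eq

section fermionic
open Conf
variable {N d : ℕ} {F : HermitianBundle.{u} (ConfModel N d) (UnorderedConf N d) ℂ}

/-- Transport in `F` along the projection of a path of ordered configurations. -/
def OrderedTransport (F : HermitianBundle.{u} (ConfModel N d) (UnorderedConf N d) ℂ)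
    {x y : OrderedConf N d} (γ : Path x y) (v : F.Fiber (forget N d x)) (w : F.Fiber (forget N d y)) :
    Prop :=
  F.IsParallelTransport (γ.map (contMDiff_forget N d).continuous) v w

theorem IsPiecewiseSmooth.map_forget {x y : OrderedConf N d} {γ : Path x y}
    (h : IsPiecewiseSmooth (ConfModel N d) γ) :
    IsPiecewiseSmooth (ConfModel N d) (γ.map (contMDiff_forget N d).continuous) :=
  h.map (forgetMap N d)

/-- The holonomy is the sign of the induced permutation, here the identity. -/
theorem IsFermionic.transport_loop_iff (hF : F.IsFermionic) {x : OrderedConf N d} {γ : Path x x}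
    (hγ : IsPiecewiseSmooth (ConfModel N d) γ) (v w : F.Fiber (forget N d x)) :
    OrderedTransport F γ v w ↔ w = v := by
  have h := hF _ _ hγ.map_forget v w
  rwa [loopPerm_map_forget, map_one, Units.val_one, Int.cast_one, one_smul] at h

/-- Going along `γ` and back is a loop, along which `v` is transported to itself; the vector reached
halfway is the transport along `γ`. -/
theorem IsFermionic.exists_transport (hF : F.IsFermionic) {x y : OrderedConf N d} {γ : Path x y}
    (hγ : IsPiecewiseSmooth (ConfModel N d) γ) (v : F.Fiber (forget N d x)) :
    ∃ w, OrderedTransport F γ v w := by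
  have h := (hF.transport_loop_iff (hγ.trans hγ.symm) v v).2 rfl
  rw [OrderedTransport, Path.map_trans] at h
  exact h.exists_left hγ.map_forget hγ.symm.map_forget

/-- Going back along `γ` and then along `γ'` is a loop at `y` which takes `w` to `w'`, and its
holonomy is trivial. -/
theorem IsFermionic.transport_unique (hF : F.IsFermionic) {x y : OrderedConf N d} {γ γ' : Path x y}
    (hγ : IsPiecewiseSmooth (ConfModel N d) γ) (hγ' : IsPiecewiseSmooth (ConfModel N d) γ')
    {v : F.Fiber (forget N d x)} {w w' : F.Fiber (forget N d y)}
    (h : OrderedTransport F γ v w) (h' : OrderedTransport F γ' v w') : w' = w := by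
  refine (hF.transport_loop_iff (hγ.symm.trans hγ') w w').1 ?_
  rw [OrderedTransport, Path.map_trans]
  exact (IsParallelTransport.symm hγ.map_forget h).trans hγ.symm.map_forget hγ'.map_forget h'

/-- Ordered configurations joined by a piecewise smooth path. -/
def joinedSetoid (N d : ℕ) : Setoid (OrderedConf N d) where
  r x y := ∃ γ : Path x y, IsPiecewiseSmooth (ConfModel N d) γ
  iseqv := ⟨fun x => ⟨_, IsPiecewiseSmooth.refl x⟩, fun ⟨_, h⟩ => ⟨_, h.symm⟩,
    fun ⟨_, h⟩ ⟨_, h'⟩ => ⟨_, h.trans h'⟩⟩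

/-- The pull-back of a fermionic line bundle has a parallel frame of unit vectors. -/
theorem IsFermionic.exists_frame (hF : F.IsFermionic) :
    ∃ e : Π x : OrderedConf N d, F.Fiber (forget N d x), (∀ x, ‖e x‖ = 1) ∧
      ∀ (x y) (γ : Path x y), IsPiecewiseSmooth (ConfModel N d) γ →
        OrderedTransport F γ (e x) (e y) := by
  have hunit : ∀ x : OrderedConf N d, ∃ v : F.Fiber (forget N d x), ‖v‖ = 1 := fun x => by
    have : Nontrivial (F.Fiber (forget N d x)) :=
      Module.nontrivial_of_finrank_pos (R := ℂ) (by rw [F.finrank_fiber, Module.finrank_self]; exact one_pos)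
    obtain ⟨v, hv⟩ := exists_ne (0 : F.Fiber (forget N d x))
    exact ⟨(‖v‖⁻¹ : ℂ) • v, norm_smul_inv_norm hv⟩
  choose u hu using hunit
  -- The base point of the class of `x`; `e x` is the transport to `x` of the unit vector chosen
  -- there.
  let r : OrderedConf N d → OrderedConf N d := fun x => (Quotient.mk (joinedSetoid N d) x).out
  have hr : ∀ x, ∃ γ : Path (r x) x, IsPiecewiseSmooth (ConfModel N d) γ := fun x =>
    Quotient.mk_out (s := joinedSetoid N d) x
  choose p hp using hr
  choose e he using fun x => hF.exists_transport (hp x) (u (r x))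
  refine ⟨e, fun x => ?_, fun x y γ hγ => ?_⟩
  · rw [← IsParallelTransport.norm_eq (hp x).map_forget (he x), hu]
  · have hxy : r x = r y := congrArg Quotient.out (Quotient.sound (s := joinedSetoid N d) ⟨γ, hγ⟩)
    obtain ⟨w, hw⟩ := hF.exists_transport hγ (e x)
    have h1 : OrderedTransport F ((p x).trans γ) (u (r x)) w := by
      rw [OrderedTransport, Path.map_trans]
      exact IsParallelTransport.trans (hp x).map_forget hγ.map_forget (he x) hw
    -- The path and the vector it starts from both depend on the base point, so the whole
    -- existential statement is rewritten along `r x = r y`.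
    have h2 : ∃ γ' : Path (r x) y, IsPiecewiseSmooth (ConfModel N d) γ' ∧
        OrderedTransport F γ' (u (r x)) (e y) := hxy ▸ ⟨p y, hp y, he y⟩
    obtain ⟨γ', hγ', h2⟩ := h2
    rwa [hF.transport_unique ((hp x).trans hγ) hγ' h1 h2]

/-- A unit vector in a line identifies the line with `ℂ`. -/
noncomputable def unitCoord {V : Type*} [NormedAddCommGroup V] [InnerProductSpace ℂ V]
    (hV : Module.finrank ℂ V = 1) (e : V) (he : ‖e‖ = 1) : V ≃ₗᵢ[ℂ] ℂ :=
  have : FiniteDimensional ℂ V := Module.finite_of_finrank_eq_succ hV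
  ((LinearIsometry.toSpanSingleton ℂ V he).toLinearIsometryEquiv
    (by rw [hV, Module.finrank_self])).symm

theorem unitCoord_smul {V : Type*} [NormedAddCommGroup V] [InnerProductSpace ℂ V]
    (hV : Module.finrank ℂ V = 1) {e : V} (he : ‖e‖ = 1) (v : V) : unitCoord hV e he v • e = v :=
  -- By construction the inverse of the coordinate map is `a ↦ a • e`.
  (unitCoord hV e he).symm_apply_apply v

end fermionic

end HermitianBundle

/-- For every `N` and every `d ≥ 2`, the pull-back of the fermionic line bundle along the covering
map from ordered to unordered configurations is a trivial Hermitian bundle. -/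
theorem mainTheorem5 (N d : ℕ) (hd : 2 ≤ d)
    (F : HermitianBundle.{u} (Conf.ConfModel N d) (Conf.UnorderedConf N d) ℂ)
    (hF : F.IsFermionic) :
    Nonempty ((F.lift (Conf.forgetMap N d)).Iso
      (HermitianBundle.trivial (Conf.ConfModel N d) (Conf.OrderedConf N d) ℂ)) := by
  obtain ⟨e, he, ht⟩ := hF.exists_frame
  have hV : ∀ x, Module.finrank ℂ (F.Fiber (Conf.forget N d x)) = 1 := fun x => by
    rw [F.finrank_fiber, Module.finrank_self]
  refine ⟨⟨fun x => HermitianBundle.unitCoord (hV x) (e x) (he x), fun {x y} γ hγ v w => ?_⟩⟩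
  refine (HermitianBundle.lift_isParallelTransport_iff _ F hγ v w).trans
    (Iff.trans ?_ (HermitianBundle.trivial_isParallelTransport_iff γ _ _).symm)
  set a := HermitianBundle.unitCoord (hV x) (e x) (he x) v with ha
  have hv : a • e x = v := HermitianBundle.unitCoord_smul (hV x) (he x) v
  -- Since the frame is parallel, transport keeps the coordinate `a` fixed. Uniqueness of transport
  -- and `e y ≠ 0` then turn the transport relation into equality of coordinates.
  have h : HermitianBundle.OrderedTransport F γ v (a • e y) :=
    hv ▸ HermitianBundle.IsParallelTransport.smul hγ.map_forget (ht x y γ hγ) a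
  have hw := HermitianBundle.unitCoord_smul (hV y) (he y) w
  constructor
  · intro h'
    have : w = a • e y := hF.transport_unique hγ hγ h h'
    refine smul_left_injective ℂ (norm_ne_zero_iff.1 (he y ▸ one_ne_zero)) ?_
    exact this.symm.trans hw.symm
  · intro h'
    have : a • e y = w := (congrArg (· • e y) h').trans hw
    exact this ▸ h
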